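/- Identify $[a\ \ b]^\top\in\mathbb R^2$ with $a+jb\in\mathbb C$ and $\left[\begin{smallmatrix}a&-b\\ b&a\end{smallmatrix}\right]$ with multiplication by $a+jb$, so that the Euclidean norm of a vector and the spectral norm of such a matrix are both the modulus. Let $p^\star,q^\star,\varphi,\omega_0,\omega_g,v_g,g_f\in\mathbb R$, $v^\star,\eta,r_g,l_g,c_f,l_f,k_p^v,k_r^v,k_p^c,k_r^c>0$, $\alpha\ge 0$, and put $\omega_\Delta=\omega_0-\omega_g$, $Z=r_g+j\omega_g l_g$, $Y=Z^{-1}$, $Y_f=g_f+j\omega_g c_f$, $S=e^{j\varphi}\frac{p^\star-jq^\star}{v^{\star2}}$. Consider the full-order (twelfth-order) converter system with state $x_1=\hat v$, $x_2=i$, $x_3=(v,\zeta_v)$, $x_4=(i_f,\zeta_c)$, all six components in $\mathbb R^2\cong\mathbb C$: $$\dot{\hat v}=j\omega_\Delta\hat v+\eta S\hat v-\eta e^{j\varphi}i+\eta\alpha\tfrac{v^{\star2}-\|\hat v\|^2}{v^{\star2}}\hat v,\qquad \dot i=l_g^{-1}(-Zi+v-v_g),$$ $$\dot v=c_f^{-1}(-Y_fv-i+i_f),\quad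 \dot\zeta_v=j\omega_\Delta\zeta_v+v-\hat v,\quad \dot i_f=l_f^{-1}\bigl(-k_p^c(i_f-i_f^\star)-k_r^c\zeta_c\bigr),\quad \dot\zeta_c=j\omega_\Delta\zeta_c+i_f-i_f^\star,$$ $$i_f^\star=-k_p^v(v-\hat v)-k_r^v\zeta_v+Y_fv+i .$$ **Theorem.** Let $\omega_\Delta=0$, let $x_{\rm s}$ be an equilibrium point of this system and $v_s$ its $\hat v$-component. Let $c_1>0$ and $\epsilon>3$ and define $c_\epsilon=\|S-e^{j\varphi}Y+\alpha\|+\alpha\epsilon\frac{\|v_s\|^2}{v^{\star2}}$, $c_v=\frac{c_f}{k_p^v}+\frac{c_f}{k_r^v}$, $\alpha_2=1$, $\alpha_3=1-\frac{c_f}{k_r^v}$, $\beta_{12}=1$, $\beta_{23}=\frac1{r_g}$, $\beta_{34}=\frac1{k_p^v}+\frac1{k_r^v}$, $\beta_{21}=c_\epsilon\eta\frac{l_g}{r_g}\|Y\|$, $\gamma_2=\eta\frac{l_g}{r_g}\|Y\|$, $\beta_{31}=c_\epsilon c_v\eta$, $\beta_{32}=c_v\eta$, $\gamma_3=0$, $\tilde\beta_{41}=c_\epsilon\eta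 k_p^v$, $\tilde\beta_{42}=\eta k_p^v+\frac{\|Z\|}{l_g}$, $\tilde\beta_{43}=\frac1{l_g}+\|Y_f-k_p^v\|\frac{k_p^v+k_r^v}{c_f}+k_r^v$, $\tilde\gamma_4=\frac{\|Y_f-k_p^v\|}{c_f}$, and, for $i=2,3$, with $b_2=\beta_{21}^2$ and $b_3=\frac14\beta_{31}^2+\beta_{32}^2$, $$c_i=\tfrac12\Bigl(\alpha_i-\gamma_i+\tfrac{\beta_{i(i-1)}}{\beta_{(i-1)i}}c_{i-1}-\sqrt{D_i}\Bigr),\quad D_i=\Bigl(\alpha_i-\gamma_i+\tfrac{\beta_{i(i-1)}}{\beta_{(i-1)i}}c_{i-1}\Bigr)^2+4\Bigl(b_i-(\alpha_i-\gamma_i)\tfrac{\beta_{i(i-1)}}{\beta_{(i-1)i}}c_{i-1}\Bigr).$$ Assume $$\text{(a)}\quad \Re\Bigl\{e^{j\varphi}\tfrac{p^\star-jq^\star}{v^{\star2}}\Bigr\}+\alpha+c_1<\tfrac12\tfrac{\alpha\|v_s\|^2}{v^{\star2}}+\Re\{e^{j\varphi}Y\},\qquad \text{(b)}\quad 0<\eta<\frac{c_1}{\frac{l_g}{r_g}\|Y\|(c_1+c_\epsilon)},$$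 $$\text{(c)}\quad 0<\frac{1+k_r^v/k_p^v}{k_r^v/c_f-1}<\frac{4c_2}{\frac1{r_g}\eta(c_\epsilon^2+4)},\qquad \text{(d)}\quad 0<\frac{1+k_r^c/k_p^c}{k_r^c/l_f-1}<\frac{4c_3}{\frac{\beta_{34}}{\tilde\beta_{43}}(\tilde\beta_{41}^2+\tilde\beta_{42}^2+4\tilde\beta_{43}^2)+c_3\tilde\gamma_4}.$$ Then the equilibrium point $x_{\rm s}$ is asymptotically stable (Lyapunov stable and locally attractive, solutions starting nearby existing for all $t\ge0$). Moreover, if $v_s\ne0$, there is $r>0$ with $\dfrac{(1+r/\|v_s\|)^3-1}{r/\|v_s\|}=\epsilon$, and the region of attraction of $x_{\rm s}$ contains $\{(x_1,x_2,x_3,x_4):\|x_1-v_s\|<r\}$. -/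

import Mathlib

noncomputable section

open Complex Filter Topology Set

/-! ### Autonomous differential equations on the half-line `[0, ∞)` -/

/-- `x` is a solution of `x' = f(x)` on `[0, ∞)`. -/
def IsForwardSolution {E : Type*} [NormedAddCommGroup E] [NormedSpace ℝ E]
    (f : E → E) (x : ℝ → E) : Prop :=
  ∀ t : ℝ, 0 ≤ t → HasDerivWithinAt x (f (x t)) (Ici 0) t

/-- The region of attraction of `xe`: the initial states from which a solution exists for all
forward time and from which every solution converges to `xe`. -/
def regionOfAttraction {E : Type*} [NormedAddCommGroup E] [NormedSpace ℝ E]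
    (f : E → E) (xe : E) : Set E :=
  {x₀ | (∃ x : ℝ → E, IsForwardSolution f x ∧ x 0 = x₀) ∧
    ∀ x : ℝ → E, IsForwardSolution f x → x 0 = x₀ → Tendsto x atTop (𝓝 xe)}

/-- Lyapunov stability: solutions that start close to `xe` exist for all forward time and stay
close to `xe`. -/
def LyapunovStable {E : Type*} [NormedAddCommGroup E] [NormedSpace ℝ E]
    (f : E → E) (xe : E) : Prop :=
  ∀ ρ : ℝ, 0 < ρ → ∃ δ : ℝ, 0 < δ ∧ ∀ x₀ : E, ‖x₀ - xe‖ < δ →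
    (∃ x : ℝ → E, IsForwardSolution f x ∧ x 0 = x₀) ∧
    ∀ x : ℝ → E, IsForwardSolution f x → x 0 = x₀ → ∀ t : ℝ, 0 ≤ t → ‖x t - xe‖ < ρ

/-- Asymptotic stability of an equilibrium: Lyapunov stability and local attractivity. -/
def AsymptoticallyStable {E : Type*} [NormedAddCommGroup E] [NormedSpace ℝ E]
    (f : E → E) (xe : E) : Prop :=
  f xe = 0 ∧ LyapunovStable f xe ∧ regionOfAttraction f xe ∈ 𝓝 xe

/-! ### The grid-connected converter

A vector `[a b]ᵀ` of `ℝ²` is written as the complex number `a + jb`, and a matrix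
`[a -b; b a]` as multiplication by `a + jb`; the Euclidean norm of the vector and the spectral
norm of the matrix are then both the modulus. -/

/-- Setpoints, gains, and circuit and grid parameters. -/
structure GridConverter where
  /-- active power setpoint -/
  pStar : ℝ
  /-- reactive power setpoint -/
  qStar : ℝ
  /-- voltage setpoint -/
  vStar : ℝ
  /-- rotation angle -/
  φ : ℝ
  /-- power droop gain -/
  η : ℝ
  /-- voltage droop gain -/
  α : ℝ
  /-- nominal frequency -/
  ω₀ : ℝ
  /-- grid frequency -/
  ωg : ℝ
  /-- grid voltage (in the frame oriented along it) -/
  vg : ℝ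
  /-- grid resistance -/
  rg : ℝ
  /-- grid inductance -/
  lg : ℝ
  /-- filter conductance -/
  gf : ℝ
  /-- filter capacitance -/
  cf : ℝ
  /-- filter inductance -/
  lf : ℝ
  /-- proportional gain of the voltage loop -/
  kpv : ℝ
  /-- resonant gain of the voltage loop -/
  krv : ℝ
  /-- proportional gain of the current loop -/
  kpc : ℝ
  /-- resonant gain of the current loop -/
  krc : ℝ

/-- The state `(x₁, x₂, x₃, x₄) = (v̂, i, (v, ζᵥ), (i_f, ζ_c))`, of real dimension twelve. -/
abbrev ConverterState : Type := ℂ × ℂ × (ℂ × ℂ) × (ℂ × ℂ)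

namespace ConverterState

/-- Reference voltage `v̂ = x₁`. -/
abbrev vHat (x : ConverterState) : ℂ := x.1
/-- Output (grid) current `i = x₂`. -/
abbrev iOut (x : ConverterState) : ℂ := x.2.1
/-- Capacitor voltage `v`, first part of `x₃`. -/
abbrev vCap (x : ConverterState) : ℂ := x.2.2.1.1
/-- Resonant integrator state `ζᵥ` of the voltage loop, second part of `x₃`. -/
abbrev ζv (x : ConverterState) : ℂ := x.2.2.1.2
/-- Inductor current `i_f`, first part of `x₄`. -/
abbrev iInd (x : ConverterState) : ℂ := x.2.2.2.1
/-- Resonant integrator state `ζ_c` of the current loop, second part of `x₄`. -/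
abbrev ζc (x : ConverterState) : ℂ := x.2.2.2.2

end ConverterState

namespace GridConverter

/-- The sign conventions on the parameters. -/
structure Admissible (P : GridConverter) : Prop where
  vStar_pos : 0 < P.vStar
  η_pos : 0 < P.η
  α_nonneg : 0 ≤ P.α
  rg_pos : 0 < P.rg
  lg_pos : 0 < P.lg
  cf_pos : 0 < P.cf
  lf_pos : 0 < P.lf
  kpv_pos : 0 < P.kpv
  krv_pos : 0 < P.krv
  kpc_pos : 0 < P.kpc
  krc_pos : 0 < P.krc

/-- `ω_Δ = ω₀ - ω_g`. -/
def ωΔ (P : GridConverter) : ℝ := P.ω₀ - P.ωg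

/-- Grid impedance `z = r_g + j ω_g l_g` (the matrix `Z`). -/
def z (P : GridConverter) : ℂ := (P.rg : ℂ) + I * ((P.ωg * P.lg : ℝ) : ℂ)

/-- Grid admittance `y = 1 / z` (the matrix `Y`). -/
def y (P : GridConverter) : ℂ := (P.z)⁻¹

/-- Filter admittance `g_f + j ω_g c_f` (the matrix `Y_f`). -/
def yf (P : GridConverter) : ℂ := (P.gf : ℂ) + I * ((P.ωg * P.cf : ℝ) : ℂ)

/-- The rotation `e^{jφ}` (the matrix `R_φ`). -/
def rot (P : GridConverter) : ℂ := exp (I * (P.φ : ℂ))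

/-- The rotated normalized power setpoint `e^{jφ} (p⋆ - j q⋆) / v⋆²` (the matrix `S_φ⋆`). -/
def sStar (P : GridConverter) : ℂ :=
  P.rot * (((P.pStar : ℂ) - I * (P.qStar : ℂ)) / ((P.vStar ^ 2 : ℝ) : ℂ))

/-- The amplitude regulation term `Φ(w) = (v⋆² - ‖w‖²) / v⋆²`. -/
def ampReg (P : GridConverter) (w : ℂ) : ℝ := (P.vStar ^ 2 - ‖w‖ ^ 2) / P.vStar ^ 2

/-- The inductor current reference `i_f⋆` generated by the voltage loop. -/
def iRef (P : GridConverter) (x : ConverterState) : ℂ :=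
  -(P.kpv : ℂ) * (x.vCap - x.vHat) - (P.krv : ℂ) * x.ζv + P.yf * x.vCap + x.iOut

/-- Right-hand side of the dVOC reference model. -/
def f₁ (P : GridConverter) (x : ConverterState) : ℂ :=
  I * (P.ωΔ : ℂ) * x.vHat + (P.η : ℂ) * P.sStar * x.vHat - (P.η : ℂ) * P.rot * x.iOut
    + ((P.η * P.α * P.ampReg x.vHat : ℝ) : ℂ) * x.vHat

/-- Right-hand side of the network dynamics. -/
def f₂ (P : GridConverter) (x : ConverterState) : ℂ :=
  (P.lg : ℂ)⁻¹ * (-P.z * x.iOut + x.vCap - (P.vg : ℂ))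

/-- Right-hand side of the filter capacitor and voltage loop dynamics. -/
def f₃ (P : GridConverter) (x : ConverterState) : ℂ × ℂ :=
  ((P.cf : ℂ)⁻¹ * (-P.yf * x.vCap - x.iOut + x.iInd),
    I * (P.ωΔ : ℂ) * x.ζv + x.vCap - x.vHat)

/-- Right-hand side of the filter inductor and current loop dynamics, the internal voltage
`-k_p^c (i_f - i_f⋆) - k_r^c ζ_c + Z_f i_f + v` being inserted in `l_f i_f' + Z_f i_f + v = e`. -/
def f₄ (P : GridConverter) (x : ConverterState) : ℂ × ℂ :=
  ((P.lf : ℂ)⁻¹ * (-(P.kpc : ℂ) * (x.iInd - P.iRef x) - (P.krc : ℂ) * x.ζc),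
    I * (P.ωΔ : ℂ) * x.ζc + x.iInd - P.iRef x)

/-- The vector field of the twelfth-order system. -/
def field (P : GridConverter) (x : ConverterState) : ConverterState :=
  (P.f₁ x, P.f₂ x, P.f₃ x, P.f₄ x)

/-! ### The constants in the stability conditions

`vs` is the steady-state voltage, `c₁` and `ε` are the tunable quantities. -/

/-- `c_ε = ‖S_φ⋆ - Y_φ + α I‖ + α ε ‖vs‖² / v⋆²`. -/
def cε (P : GridConverter) (vs : ℂ) (ε : ℝ) : ℝ :=
  ‖P.sStar - P.rot * P.y + (P.α : ℂ)‖ + P.α * ε * (‖vs‖ ^ 2 / P.vStar ^ 2)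

def cv (P : GridConverter) : ℝ := P.cf / P.kpv + P.cf / P.krv

def α₂ (_P : GridConverter) : ℝ := 1
def α₃ (P : GridConverter) : ℝ := 1 - P.cf / P.krv

def β₁₂ (_P : GridConverter) : ℝ := 1
def β₂₃ (P : GridConverter) : ℝ := 1 / P.rg
def β₃₄ (P : GridConverter) : ℝ := 1 / P.kpv + 1 / P.krv

def β₂₁ (P : GridConverter) (vs : ℂ) (ε : ℝ) : ℝ := P.cε vs ε * P.η * (P.lg / P.rg) * ‖P.y‖
def γ₂ (P : GridConverter) : ℝ := P.η * (P.lg / P.rg) * ‖P.y‖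

def β₃₁ (P : GridConverter) (vs : ℂ) (ε : ℝ) : ℝ := P.cε vs ε * P.cv * P.η
def β₃₂ (P : GridConverter) : ℝ := P.cv * P.η
def γ₃ (_P : GridConverter) : ℝ := 0

/-- `β₄₁ / c_c`, where `c_c = l_f / k_p^c + l_f / k_r^c`; similarly for the next three. -/
def β₄₁t (P : GridConverter) (vs : ℂ) (ε : ℝ) : ℝ := P.cε vs ε * P.η * P.kpv
def β₄₂t (P : GridConverter) : ℝ := P.η * P.kpv + ‖P.z‖ / P.lg
def β₄₃t (P : GridConverter) : ℝ :=
  1 / P.lg + (‖P.yf - (P.kpv : ℂ)‖ * (P.kpv + P.krv) / P.cf + P.krv)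
def γ₄t (P : GridConverter) : ℝ := ‖P.yf - (P.kpv : ℂ)‖ / P.cf

/-- `D₂`, with `β₂ = [β₂₁]`. -/
def D₂ (P : GridConverter) (vs : ℂ) (c₁ ε : ℝ) : ℝ :=
  (P.α₂ - P.γ₂ + P.β₂₁ vs ε / P.β₁₂ * c₁) ^ 2
    + 4 * (P.β₂₁ vs ε ^ 2 - (P.α₂ - P.γ₂) * (P.β₂₁ vs ε / P.β₁₂) * c₁)

/-- The stability margin `c₂`. -/
def c₂ (P : GridConverter) (vs : ℂ) (c₁ ε : ℝ) : ℝ :=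
  1 / 2 * (P.α₂ - P.γ₂ + P.β₂₁ vs ε / P.β₁₂ * c₁ - √(P.D₂ vs c₁ ε))

/-- `D₃`, with `β₃ = [β₃₁ / 2, β₃₂]`. -/
def D₃ (P : GridConverter) (vs : ℂ) (c₁ ε : ℝ) : ℝ :=
  (P.α₃ - P.γ₃ + P.β₃₂ / P.β₂₃ * P.c₂ vs c₁ ε) ^ 2
    + 4 * (((1 / 2 * P.β₃₁ vs ε) ^ 2 + P.β₃₂ ^ 2)
      - (P.α₃ - P.γ₃) * (P.β₃₂ / P.β₂₃) * P.c₂ vs c₁ ε)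

/-- The stability margin `c₃`. -/
def c₃ (P : GridConverter) (vs : ℂ) (c₁ ε : ℝ) : ℝ :=
  1 / 2 * (P.α₃ - P.γ₃ + P.β₃₂ / P.β₂₃ * P.c₂ vs c₁ ε - √(P.D₃ vs c₁ ε))

/-- The four quantitative stability conditions at the steady-state voltage `vs`, for a margin
`c₁ > 0` and a parameter `ε > 3`. -/
structure StabilityConditions (P : GridConverter) (vs : ℂ) (c₁ ε : ℝ) : Prop where
  c₁_pos : 0 < c₁
  three_lt_ε : 3 < ε
  condA : (P.sStar).re + P.α + c₁
    < 1 / 2 * (P.α * ‖vs‖ ^ 2 / P.vStar ^ 2) + (P.rot * P.y).re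
  condB : 0 < P.η ∧ P.η < c₁ / (P.lg / P.rg * ‖P.y‖ * (c₁ + P.cε vs ε))
  condC : 0 < (1 + P.krv / P.kpv) / (P.krv / P.cf - 1) ∧
    (1 + P.krv / P.kpv) / (P.krv / P.cf - 1)
      < 4 * P.c₂ vs c₁ ε / (1 / P.rg * P.η * (P.cε vs ε ^ 2 + 4))
  condD : 0 < (1 + P.krc / P.kpc) / (P.krc / P.lf - 1) ∧
    (1 + P.krc / P.kpc) / (P.krc / P.lf - 1)
      < 4 * P.c₃ vs c₁ ε / (P.β₃₄ / P.β₄₃t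
          * (P.β₄₁t vs ε ^ 2 + P.β₄₂t ^ 2 + 4 * P.β₄₃t ^ 2)
        + P.c₃ vs c₁ ε * P.γ₄t)

end GridConverter

end

/-! Measure every layer of the converter (reference voltage, network, voltage loop, current loop)
from the quasi-steady state that the slower layers impose on it. Each layer then has a storage
function that decays along the layer in isolation, and the couplings are controlled by the decay
rates, so that adding one layer at a time comes down to a symmetric `2 × 2` matrix. Its smaller
eigenvalue is the next margin `c₂`, `c₃`, and conditions (b), (c), (d) make these margins and that
of the whole cascade positive.

The delicate layer is the reference voltage. There the cubic amplitude regulation acts on the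
deviation `δ` as multiplication by a complex number `σ` in a sector. A quadratic form plus a
multiple of the antiderivative of the cubic has a gradient proportional to `(‖k‖² + Re k σ) δ`,
and its inner product with the field `(k + σ) δ` dominates the squares of the gradient and of the
field on the whole plane, not merely near the equilibrium. The weighted sum of the storage
functions is therefore a proper strict Lyapunov function, and every solution converges to the
equilibrium. -/

open Complex Filter Topology Set

/-! ### The Barbashin–Krasovskii theorem -/

section StrictLyapunov

variable {E : Type*} [NormedAddCommGroup E] [NormedSpace ℝ E]

theorem exists_isForwardSolution_of_hasCompactSupport [CompleteSpace E] {g : E → E}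
    (hg : ContDiff ℝ 1 g) (hgc : HasCompactSupport g) (x₀ : E) :
    ∃ x : ℝ → E, IsForwardSolution g x ∧ x 0 = x₀ := by
  obtain ⟨K, hK⟩ := hg.lipschitzWith_of_hasCompactSupport hgc one_ne_zero
  obtain ⟨L, hL⟩ := hgc.exists_bound_of_continuous hg.continuous
  have hlocal (y : E) : ∃ x : ℝ → E, x 0 = y ∧
      IsMIntegralCurveOn (I := modelWithCornersSelf ℝ E) x g (Ioo (-1) 1) := by
    have hpl : IsPicardLindelof (fun _ => g) (⟨0, by simp⟩ : Icc (-1 : ℝ) 1) y L.toNNReal 0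
        L.toNNReal K :=
      { lipschitzOnWith := fun _ _ => hK.lipschitzOnWith
        continuousOn := fun _ _ => continuousOn_const
        norm_le := fun _ _ x _ => (hL x).trans (Real.le_coe_toNNReal L)
        mul_max_le := by simp }
    obtain ⟨x, hx0, hx⟩ := hpl.exists_eq_forall_mem_Icc_hasDerivWithinAt₀
    refine ⟨x, hx0, fun t ht => ?_⟩
    have hderiv := (hx t (Ioo_subset_Icc_self ht)).mono Ioo_subset_Icc_self
    exact hderiv.hasFDerivWithinAt.hasMFDerivWithinAt
  obtain ⟨x, hx0, hx⟩ := exists_isMIntegralCurve_of_isMIntegralCurveOn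
    (contMDiff_vectorSpace_iff_contDiff.2 hg) one_pos hlocal x₀
  refine ⟨x, fun t _ => ?_, hx0⟩
  have hderiv : HasDerivAt x (g (x t)) t := hasMFDerivAt_iff_hasFDerivAt.1 (hx t)
  exact hderiv.hasDerivWithinAt

/-- `V` is a strict Lyapunov function for the equilibrium `xe` of `x' = f(x)` on the whole space:
it is proper and positive definite, and strictly decreasing along every solution other than the
equilibrium. -/
structure IsStrictLyapunov (f : E → E) (xe : E) (V : E → ℝ) : Prop where
  contDiff : ContDiff ℝ 1 V
  apply_self : V xe = 0
  pos : ∀ x, x ≠ xe → 0 < V x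
  coercive : Tendsto V (cocompact E) atTop
  decrease : ∀ x, x ≠ xe → fderiv ℝ V x (f x) < 0

namespace IsStrictLyapunov

variable {f : E → E} {xe : E} {V : E → ℝ}

theorem nonneg (h : IsStrictLyapunov f xe V) (x : E) : 0 ≤ V x := by
  rcases eq_or_ne x xe with rfl | hx
  exacts [h.apply_self.ge, (h.pos x hx).le]

theorem isCompact_sublevel (h : IsStrictLyapunov f xe V) (a : ℝ) : IsCompact {x | V x ≤ a} := by
  obtain ⟨K, hK, hKV⟩ := mem_cocompact.1 (h.coercive.eventually_gt_atTop a)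
  refine hK.of_isClosed_subset (isClosed_le h.contDiff.continuous continuous_const) ?_
  intro x hx
  by_contra hxK
  exact not_lt_of_ge (mem_ofPred.1 hx) (mem_ofPred.1 (hKV hxK))

theorem exists_norm_sub_lt_of_apply_lt (h : IsStrictLyapunov f xe V) {ρ : ℝ} (hρ : 0 < ρ) :
    ∃ e > 0, ∀ x, V x < e → ‖x - xe‖ < ρ := by
  have hK : IsCompact ({x | V x ≤ 1} \ Metric.ball xe ρ) :=
    (h.isCompact_sublevel 1).diff Metric.isOpen_ball
  rcases eq_empty_or_nonempty ({x | V x ≤ 1} \ Metric.ball xe ρ) with hempty | hne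
  · refine ⟨1, one_pos, fun x hx => ?_⟩
    rw [← mem_ball_iff_norm]
    exact sdiff_eq_empty.1 hempty hx.le
  · obtain ⟨y, hy, hmin⟩ := hK.exists_isMinOn hne h.contDiff.continuous.continuousOn
    have hyxe : y ≠ xe := by
      rintro rfl
      exact hy.2 (Metric.mem_ball_self hρ)
    refine ⟨min 1 (V y), lt_min one_pos (h.pos y hyxe), fun x hx => ?_⟩
    rw [← mem_ball_iff_norm]
    by_contra hxρ
    exact (hx.trans_le (min_le_right _ _)).not_ge
      (hmin ⟨(hx.trans_le (min_le_left _ _)).le, hxρ⟩)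

/-- The factor `χ` is a cut-off when solutions are constructed, and `1` afterwards. -/
theorem antitoneOn_comp (h : IsStrictLyapunov f xe V) (hf : f xe = 0) {χ : E → ℝ}
    (hχ : ∀ x, 0 ≤ χ x) {x : ℝ → E} (hx : IsForwardSolution (fun y => χ y • f y) x) :
    AntitoneOn (fun t => V (x t)) (Ici 0) := by
  have hderiv : ∀ t ∈ Ici (0 : ℝ), HasDerivWithinAt (fun τ => V (x τ))
      (fderiv ℝ V (x t) (χ (x t) • f (x t))) (Ici 0) t := fun t ht =>
    ((h.contDiff.differentiable one_ne_zero (x t)).hasFDerivAt).comp_hasDerivWithinAt t (hx t ht)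
  refine antitoneOn_of_hasDerivWithinAt_nonpos (convex_Ici 0)
    (fun t ht => (hderiv t ht).continuousWithinAt)
    (fun t ht => (hderiv t (interior_subset ht)).mono interior_subset) fun t _ => ?_
  rw [map_smul, smul_eq_mul]
  refine mul_nonpos_of_nonneg_of_nonpos (hχ _) ?_
  rcases eq_or_ne (x t) xe with hxe | hxe
  · simp [hxe, hf]
  · exact (h.decrease _ hxe).le

theorem antitoneOn (h : IsStrictLyapunov f xe V) (hf : f xe = 0) {x : ℝ → E}
    (hx : IsForwardSolution f x) : AntitoneOn (fun t => V (x t)) (Ici 0) :=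
  h.antitoneOn_comp hf (χ := fun _ => 1) (fun _ => zero_le_one) (by simpa only [one_smul] using hx)

theorem exists_isForwardSolution [FiniteDimensional ℝ E] (h : IsStrictLyapunov f xe V)
    (hf : ContDiff ℝ 1 f) (hfxe : f xe = 0) (x₀ : E) :
    ∃ x : ℝ → E, IsForwardSolution f x ∧ x 0 = x₀ := by
  obtain ⟨ρ, hρ, hsub⟩ := (h.isCompact_sublevel (V x₀)).isBounded.subset_closedBall_lt 0 xe
  let χ : ContDiffBump xe := ⟨ρ, ρ + 1, hρ, lt_add_one ρ⟩
  obtain ⟨x, hx, hx0⟩ := exists_isForwardSolution_of_hasCompactSupport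
    (χ.contDiff.smul hf) χ.hasCompactSupport.smul_right x₀
  refine ⟨x, fun t ht => ?_, hx0⟩
  have hVx : V (x t) ≤ V x₀ :=
    hx0 ▸ h.antitoneOn_comp hfxe (fun _ => χ.nonneg) hx self_mem_Ici ht ht
  simpa only [Pi.smul_apply', χ.one_of_mem_closedBall (hsub hVx), one_smul] using hx t ht

theorem exists_apply_lt (h : IsStrictLyapunov f xe V) (hf : Continuous f) (hfxe : f xe = 0)
    {x : ℝ → E} (hx : IsForwardSolution f x) {e : ℝ} (he : 0 < e) : ∃ T ≥ 0, V (x T) < e := by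
  by_contra! hcon
  have hanti := h.antitoneOn hfxe hx
  have hmem : ∀ t ≥ (0 : ℝ), x t ∈ {y | V y ≤ V (x 0)} ∩ {y | e ≤ V y} := fun t ht =>
    ⟨hanti self_mem_Ici ht ht, hcon t ht⟩
  have hV := h.contDiff
  obtain ⟨y, hy, hmax⟩ := ((h.isCompact_sublevel (V (x 0))).inter_right
    (isClosed_le continuous_const hV.continuous)).exists_isMaxOn ⟨x 0, hmem 0 le_rfl⟩
    ((hV.continuous_fderiv one_ne_zero).clm_apply hf).continuousOn
  have hyxe : y ≠ xe := by
    rintro rfl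
    exact he.not_ge (h.apply_self ▸ hy.2)
  set γ : ℝ := -fderiv ℝ V y (f y)
  have hγ : 0 < γ := neg_pos.2 (h.decrease y hyxe)
  have hderiv : ∀ t ∈ Ici (0 : ℝ), HasDerivWithinAt (fun τ => V (x τ) + γ * τ)
      (fderiv ℝ V (x t) (f (x t)) + γ) (Ici 0) t := fun t ht => by
    simpa only [mul_one, Function.comp_apply, id] using
      (((hV.differentiable one_ne_zero (x t)).hasFDerivAt).comp_hasDerivWithinAt t
        (hx t ht)).fun_add ((hasDerivWithinAt_id t (Ici 0)).const_mul γ)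
  have hline : AntitoneOn (fun t => V (x t) + γ * t) (Ici 0) :=
    antitoneOn_of_hasDerivWithinAt_nonpos (convex_Ici 0)
      (fun t ht => (hderiv t ht).continuousWithinAt)
      (fun t ht => (hderiv t (interior_subset ht)).mono interior_subset) fun t ht => by
        have := isMaxOn_iff.1 hmax _ (hmem t (interior_subset ht))
        linarith
  have hT : 0 ≤ V (x 0) / γ := div_nonneg (h.nonneg _) hγ.le
  have hlt := hline self_mem_Ici hT hT
  simp only [mul_zero, add_zero, mul_div_cancel₀ _ hγ.ne'] at hlt
  linarith [hcon _ hT]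

theorem tendsto (h : IsStrictLyapunov f xe V) (hf : Continuous f) (hfxe : f xe = 0)
    {x : ℝ → E} (hx : IsForwardSolution f x) : Tendsto x atTop (𝓝 xe) := by
  refine Metric.tendsto_atTop.2 fun ρ hρ => ?_
  obtain ⟨e, he, hball⟩ := h.exists_norm_sub_lt_of_apply_lt hρ
  obtain ⟨T, hT, hVT⟩ := h.exists_apply_lt hf hfxe hx he
  refine ⟨T, fun t ht => ?_⟩
  rw [dist_eq_norm]
  exact hball _ ((h.antitoneOn hfxe hx hT (hT.trans ht) ht).trans_lt hVT)

theorem regionOfAttraction_eq_univ [FiniteDimensional ℝ E] (h : IsStrictLyapunov f xe V)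
    (hf : ContDiff ℝ 1 f) (hfxe : f xe = 0) : regionOfAttraction f xe = univ :=
  eq_univ_of_forall fun x₀ =>
    ⟨h.exists_isForwardSolution hf hfxe x₀, fun _ hx _ => h.tendsto hf.continuous hfxe hx⟩

theorem lyapunovStable [FiniteDimensional ℝ E] (h : IsStrictLyapunov f xe V)
    (hf : ContDiff ℝ 1 f) (hfxe : f xe = 0) : LyapunovStable f xe := by
  intro ρ hρ
  obtain ⟨e, he, hball⟩ := h.exists_norm_sub_lt_of_apply_lt hρ
  obtain ⟨δ, hδ, hVδ⟩ := Metric.eventually_nhds_iff_ball.1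
    (h.contDiff.continuous.continuousAt.eventually_lt_const (h.apply_self.trans_lt he))
  refine ⟨δ, hδ, fun x₀ hx₀ => ⟨h.exists_isForwardSolution hf hfxe x₀, ?_⟩⟩
  rintro x hx rfl t ht
  exact hball _ ((h.antitoneOn hfxe hx self_mem_Ici ht ht).trans_lt
    (hVδ _ (mem_ball_iff_norm.2 hx₀)))

theorem asymptoticallyStable [FiniteDimensional ℝ E] (h : IsStrictLyapunov f xe V)
    (hf : ContDiff ℝ 1 f) (hfxe : f xe = 0) : AsymptoticallyStable f xe :=
  ⟨hfxe, h.lyapunovStable hf hfxe, by simp only [h.regionOfAttraction_eq_univ hf hfxe, univ_mem]⟩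

theorem comp_clm_sub [FiniteDimensional ℝ E] {F : Type*} [NormedAddCommGroup F] [NormedSpace ℝ F]
    {g : F → F} {U : F → ℝ} (h : IsStrictLyapunov g 0 U) (T : E →L[ℝ] F)
    (hT : Function.Injective T) (hfg : ∀ x, T (f x) = g (T (x - xe))) :
    IsStrictLyapunov f xe (fun x => U (T (x - xe))) where
  contDiff := h.contDiff.comp (T.contDiff.comp (contDiff_id.sub contDiff_const))
  apply_self := by simpa using h.apply_self
  pos x hx := h.pos _ fun h0 => hx (sub_eq_zero.1 (hT (h0.trans (map_zero T).symm)))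
  coercive := by
    have hsub : Tendsto (fun x => x - xe) (cocompact E) (cocompact E) :=
      (Homeomorph.subRight xe).isClosedEmbedding.tendsto_cocompact
    have hemb := T.toLinearMap.isClosedEmbedding_of_injective (LinearMap.ker_eq_bot.2 hT)
    exact h.coercive.comp (hemb.tendsto_cocompact.comp hsub)
  decrease x hx := by
    have hTx : T (x - xe) ≠ 0 := fun h0 => hx (sub_eq_zero.1 (hT (h0.trans (map_zero T).symm)))
    have hderiv : HasFDerivAt (fun x => U (T (x - xe)))
        ((fderiv ℝ U (T (x - xe))).comp T) x :=
      (h.contDiff.differentiable one_ne_zero _).hasFDerivAt.comp x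
        (T.hasFDerivAt.comp x (hasFDerivAt_sub_const xe))
    rw [hderiv.fderiv, ContinuousLinearMap.comp_apply, hfg]
    exact h.decrease _ hTx

end IsStrictLyapunov

end StrictLyapunov

/-! ### Quadratic forms -/

/-- `V` dominates a positive multiple of the squared norm. This makes a quadratic storage function
positive definite and proper, and is inherited by positive combinations on products. -/
def HasQuadraticGrowth {E : Type*} [Norm E] (V : E → ℝ) : Prop :=
  ∃ k > 0, ∀ x, k * ‖x‖ ^ 2 ≤ V x

theorem sq_norm_prod_le {E F : Type*} [SeminormedAddGroup E] [SeminormedAddGroup F] (p : E × F) :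
    ‖p‖ ^ 2 ≤ ‖p.1‖ ^ 2 + ‖p.2‖ ^ 2 := by
  rcases max_choice ‖p.1‖ ‖p.2‖ with h | h <;> rw [Prod.norm_def, h]
  · exact le_add_of_nonneg_right (sq_nonneg _)
  · exact le_add_of_nonneg_left (sq_nonneg _)

theorem norm_smul_add_smul_le_sqrt_mul {E : Type*} [SeminormedAddCommGroup E] [NormedSpace ℝ E]
    (a b : ℝ) (p : E × E) :
    ‖a • p.1 + b • p.2‖ ≤ √(a ^ 2 + b ^ 2) * ‖WithLp.toLp 2 p‖ := by
  rw [WithLp.prod_norm_eq_of_L2, ← Real.sqrt_mul (by positivity)]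
  refine Real.le_sqrt_of_sq_le ?_
  calc ‖a • p.1 + b • p.2‖ ^ 2 ≤ (|a| * ‖p.1‖ + |b| * ‖p.2‖) ^ 2 := by
        grw [norm_add_le, norm_smul, norm_smul, Real.norm_eq_abs, Real.norm_eq_abs]
    _ ≤ (|a| ^ 2 + |b| ^ 2) * (‖p.1‖ ^ 2 + ‖p.2‖ ^ 2) := by
        linarith [sq_nonneg (|a| * ‖p.2‖ - |b| * ‖p.1‖)]
    _ = (a ^ 2 + b ^ 2) * (‖p.1‖ ^ 2 + ‖p.2‖ ^ 2) := by rw [sq_abs, sq_abs]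

namespace HasQuadraticGrowth

variable {E F : Type*} [NormedAddCommGroup E] [NormedAddCommGroup F] {V : E → ℝ} {W : F → ℝ}

theorem pos (hV : HasQuadraticGrowth V) {x : E} (hx : x ≠ 0) : 0 < V x := by
  obtain ⟨k, hk, hkV⟩ := hV
  exact (mul_pos hk (pow_pos (norm_pos_iff.2 hx) 2)).trans_le (hkV x)

theorem tendsto_cocompact [ProperSpace E] (hV : HasQuadraticGrowth V) :
    Tendsto V (cocompact E) atTop := by
  obtain ⟨k, hk, hkV⟩ := hV
  have hnorm : Tendsto (fun x : E => ‖x‖ ^ 2) (cocompact E) atTop :=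
    (tendsto_pow_atTop two_ne_zero).comp (tendsto_norm_cocompact_atTop (E := E))
  exact tendsto_atTop_mono hkV (hnorm.const_mul_atTop hk)

theorem const_mul (hV : HasQuadraticGrowth V) {c : ℝ} (hc : 0 < c) :
    HasQuadraticGrowth fun x => c * V x := by
  obtain ⟨k, hk, hkV⟩ := hV
  refine ⟨c * k, by positivity, fun x => ?_⟩
  rw [mul_assoc]
  exact mul_le_mul_of_nonneg_left (hkV x) hc.le

theorem prod (hV : HasQuadraticGrowth V) (hW : HasQuadraticGrowth W) :
    HasQuadraticGrowth fun p : E × F => V p.1 + W p.2 := by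
  obtain ⟨k, hk, hkV⟩ := hV
  obtain ⟨l, hl, hlW⟩ := hW
  refine ⟨min k l, lt_min hk hl, fun p => ?_⟩
  calc
    min k l * ‖p‖ ^ 2 ≤ min k l * (‖p.1‖ ^ 2 + ‖p.2‖ ^ 2) := by
      gcongr
      exact sq_norm_prod_le p
    _ = min k l * ‖p.1‖ ^ 2 + min k l * ‖p.2‖ ^ 2 := mul_add ..
    _ ≤ k * ‖p.1‖ ^ 2 + l * ‖p.2‖ ^ 2 := by
      gcongr
      exacts [min_le_left k l, min_le_right k l]
    _ ≤ V p.1 + W p.2 := add_le_add (hkV p.1) (hlW p.2)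

end HasQuadraticGrowth

theorem two_mul_mul_le_of_sq_le {A C T : ℝ} (hA : 0 ≤ A) (hC : 0 ≤ C) (hT : T ^ 2 ≤ A * C)
    (y : ℝ) : 2 * (T * y) ≤ A + C * y ^ 2 := by
  refine le_of_abs_le (abs_le_of_sq_le_sq ?_ (by positivity))
  calc (2 * (T * y)) ^ 2 = 4 * y ^ 2 * T ^ 2 := by ring
    _ ≤ 4 * y ^ 2 * (A * C) := by gcongr
    _ ≤ (A + C * y ^ 2) ^ 2 := by linarith [sq_nonneg (A - C * y ^ 2)]

/-- The smaller eigenvalue of the symmetric matrix `[p -b; -b q]`, as a function of `B = b²`.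
The stability margins `c₂` and `c₃` are of this form. -/
noncomputable def minEigenvalue (p q B : ℝ) : ℝ :=
  1 / 2 * (p + q - √((p + q) ^ 2 + 4 * (B - p * q)))

section MinEigenvalue

variable {p q B : ℝ}

theorem sub_minEigenvalue_mul_sub_minEigenvalue (hB : 0 ≤ B) :
    (p - minEigenvalue p q B) * (q - minEigenvalue p q B) = B := by
  have hsq : √((p + q) ^ 2 + 4 * (B - p * q)) ^ 2 = (p + q) ^ 2 + 4 * (B - p * q) :=
    Real.sq_sqrt (by linarith [sq_nonneg (p - q)])
  unfold minEigenvalue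
  linear_combination hsq / 4

theorem minEigenvalue_le_left (hB : 0 ≤ B) : minEigenvalue p q B ≤ p := by
  have h : q - p ≤ √((p + q) ^ 2 + 4 * (B - p * q)) := Real.le_sqrt_of_sq_le (by linarith)
  unfold minEigenvalue
  linarith

theorem minEigenvalue_le_right (hB : 0 ≤ B) : minEigenvalue p q B ≤ q := by
  have h : p - q ≤ √((p + q) ^ 2 + 4 * (B - p * q)) := Real.le_sqrt_of_sq_le (by linarith)
  unfold minEigenvalue
  linarith

theorem minEigenvalue_pos (hp : 0 < p) (hq : 0 < q) (hB : B < p * q) :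
    0 < minEigenvalue p q B := by
  have h : √((p + q) ^ 2 + 4 * (B - p * q)) < p + q :=
    (Real.sqrt_lt' (by positivity)).2 (by linarith)
  unfold minEigenvalue
  linarith

theorem minEigenvalue_mul_le {S T : ℝ} (hB : 0 ≤ B) (hS : 0 ≤ S) (hT : T ^ 2 ≤ B * S) (y : ℝ) :
    minEigenvalue p q B * (S + y ^ 2) ≤ p * S - 2 * (T * y) + q * y ^ 2 := by
  have hT' : T ^ 2 ≤ (p - minEigenvalue p q B) * S * (q - minEigenvalue p q B) := by
    rwa [mul_right_comm, sub_minEigenvalue_mul_sub_minEigenvalue hB]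
  linarith [two_mul_mul_le_of_sq_le
    (mul_nonneg (sub_nonneg.2 (minEigenvalue_le_left hB)) hS)
    (sub_nonneg.2 (minEigenvalue_le_right hB)) hT' y]

/-- `u` and `v` are the rates of the storage functions of a cascade and of the subsystem that is
added to it, `κ` and `μ` the strengths of the coupling between the two, and `r` the input from
the next subsystem. -/
theorem mul_add_le_neg_minEigenvalue {w c α S ψ u v κ μ r : ℝ} (hw : 0 ≤ w) (hS : 0 ≤ S)
    (hB : 0 ≤ B) (hu : u ≤ -c * S + κ * ψ) (hv : v ≤ -α * ψ ^ 2 + μ * ψ + r)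
    (hcross : ((w * κ + μ) / 2) ^ 2 ≤ B * S) :
    w * u + v ≤ -minEigenvalue (w * c) α B * (S + ψ ^ 2) + r := by
  linarith [mul_le_mul_of_nonneg_left hu hw,
    minEigenvalue_mul_le (p := w * c) (q := α) hB hS hcross ψ]

end MinEigenvalue

/-! ### The proportional-resonant loop -/

section LoopStorage

variable {E : Type*} [NormedAddCommGroup E] [InnerProductSpace ℝ E]

/-- Storage function of the loop `c e' = -kp e - kr ζ`, `ζ' = e`, as a function of `(e, ζ)`; the
weights make its derivative along the loop equal to `-(1 - c / kr) ‖e‖² - ‖ζ‖²`. -/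
noncomputable def loopStorage (c kp kr : ℝ) (p : E × E) : ℝ :=
  (c / kp * ‖p.1‖ ^ 2 + 2 * (c / kr) * inner ℝ p.1 p.2 + (kr / kp + kp / kr) * ‖p.2‖ ^ 2) / 2

/-- Velocity of the pair `(e, ζ)` in the loop `c (e' - w) = -kp e - kr ζ`, `ζ' = e` with
disturbance `w`. -/
noncomputable def loopField (c kp kr : ℝ) (w : E) (p : E × E) : E × E :=
  (c⁻¹ • (-(kp • p.1) - kr • p.2) + w, p.1)

theorem loopStorage_zero (c kp kr : ℝ) : loopStorage c kp kr (0 : E × E) = 0 := by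
  simp [loopStorage]

theorem contDiff_loopStorage (c kp kr : ℝ) :
    ContDiff ℝ 1 (loopStorage c kp kr : E × E → ℝ) := by
  unfold loopStorage
  exact ((contDiff_const.mul (contDiff_fst.norm_sq ℝ)).add
    (contDiff_const.mul (contDiff_fst.inner ℝ contDiff_snd))).add
    (contDiff_const.mul (contDiff_snd.norm_sq ℝ)) |>.div_const 2

theorem fderiv_loopStorage_apply (c kp kr : ℝ) (p q : E × E) :
    fderiv ℝ (loopStorage c kp kr) p q = c / kp * inner ℝ p.1 q.1
      + c / kr * (inner ℝ p.1 q.2 + inner ℝ p.2 q.1) + (kr / kp + kp / kr) * inner ℝ p.2 q.2 := by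
  have hfst : HasFDerivAt (Prod.fst : E × E → E) (.fst ℝ E E) p := hasFDerivAt_fst
  have hsnd : HasFDerivAt (Prod.snd : E × E → E) (.snd ℝ E E) p := hasFDerivAt_snd
  have h := (((hfst.norm_sq.const_mul (c / kp)).add
    ((hfst.inner ℝ hsnd).const_mul (2 * (c / kr)))).add
    (hsnd.norm_sq.const_mul (kr / kp + kp / kr))).mul_const 2⁻¹
  rw [HasFDerivAt.fderiv (f := loopStorage c kp kr) h]
  simp [real_inner_comm q.1 p.2]
  ring

theorem hasQuadraticGrowth_loopStorage {c kp kr : ℝ} (hc : 0 < c) (hkp : 0 < kp) (hckr : c < kr) :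
    HasQuadraticGrowth (loopStorage c kp kr : E × E → ℝ) := by
  have hkr : 0 < kr := hc.trans hckr
  have hdet : (c / kr) ^ 2 < c / kp * (kr / kp + kp / kr) := by
    have hratio : c / kr < 1 := (div_lt_one hkr).2 hckr
    calc (c / kr) ^ 2 = c / kr * (c / kr) := sq _
      _ < c / kr * 1 := by gcongr
      _ ≤ c * kr / kp ^ 2 + c / kr := by rw [mul_one]; exact le_add_of_nonneg_left (by positivity)
      _ = c / kp * (kr / kp + kp / kr) := by field_simp
  have hμ : 0 < minEigenvalue (c / kp) (kr / kp + kp / kr) ((c / kr) ^ 2) :=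
    minEigenvalue_pos (by positivity) (by positivity) hdet
  refine ⟨_, half_pos hμ, fun p => ?_⟩
  have hform := minEigenvalue_mul_le (p := c / kp) (q := kr / kp + kp / kr) (B := (c / kr) ^ 2)
    (T := c / kr * ‖p.1‖) (by positivity) (sq_nonneg ‖p.1‖) (mul_pow ..).le ‖p.2‖
  have hinner : c / kr * (-(‖p.1‖ * ‖p.2‖)) ≤ c / kr * inner ℝ p.1 p.2 :=
    mul_le_mul_of_nonneg_left (neg_le_of_abs_le (abs_real_inner_le_norm p.1 p.2)) (by positivity)
  have hp := mul_le_mul_of_nonneg_left (sq_norm_prod_le p) (half_pos hμ).le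
  unfold loopStorage
  linarith

theorem fderiv_loopStorage_loopField {c kp kr : ℝ} (hc : c ≠ 0) (hkp : kp ≠ 0) (hkr : kr ≠ 0)
    (w : E) (p : E × E) :
    fderiv ℝ (loopStorage c kp kr) p (loopField c kp kr w p) =
      -(1 - c / kr) * ‖p.1‖ ^ 2 - ‖p.2‖ ^ 2
        + (c / kp * inner ℝ p.1 w + c / kr * inner ℝ p.2 w) := by
  rw [fderiv_loopStorage_apply]
  simp only [loopField, inner_add_right, inner_sub_right, inner_neg_right, real_inner_smul_right,
    real_inner_self_eq_norm_sq, real_inner_comm p.2 p.1]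
  field_simp
  ring

theorem fderiv_loopStorage_loopField_le {c kp kr : ℝ} (hc : 0 < c) (hkp : 0 < kp) (hkr : 0 < kr)
    (w : E) (p : E × E) :
    fderiv ℝ (loopStorage c kp kr) p (loopField c kp kr w p) ≤
      -(1 - c / kr) * ‖WithLp.toLp 2 p‖ ^ 2 + (c / kp + c / kr) * ‖w‖ * ‖WithLp.toLp 2 p‖ := by
  have hfst : ‖p.1‖ ≤ ‖WithLp.toLp 2 p‖ := WithLp.norm_fst_le E (WithLp.toLp 2 p)
  have hsnd : ‖p.2‖ ≤ ‖WithLp.toLp 2 p‖ := WithLp.norm_snd_le E (WithLp.toLp 2 p)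
  have hinner₁ : inner ℝ p.1 w ≤ ‖w‖ * ‖WithLp.toLp 2 p‖ := by
    grw [real_inner_le_norm, mul_comm, hfst]
  have hinner₂ : inner ℝ p.2 w ≤ ‖w‖ * ‖WithLp.toLp 2 p‖ := by
    grw [real_inner_le_norm, mul_comm, hsnd]
  have hinput : c / kp * inner ℝ p.1 w + c / kr * inner ℝ p.2 w ≤
      (c / kp + c / kr) * ‖w‖ * ‖WithLp.toLp 2 p‖ := by
    rw [mul_assoc, add_mul]
    gcongr
  have hζ : 0 ≤ c / kr * ‖p.2‖ ^ 2 := by positivity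
  rw [fderiv_loopStorage_loopField hc.ne' hkp.ne' hkr.ne', WithLp.prod_norm_sq_eq_of_L2]
  simp only [WithLp.toLp_fst, WithLp.toLp_snd]
  linarith

end LoopStorage

/-! ### The planar model -/

theorem real_inner_eq_re_mul_re_add_im_mul_im (z w : ℂ) :
    inner ℝ z w = z.re * w.re + z.im * w.im := by
  simp [Complex.inner, mul_comm]

theorem sq_norm_eq_sq_re_add_sq_im (z : ℂ) : ‖z‖ ^ 2 = z.re ^ 2 + z.im ^ 2 := by
  rw [Complex.sq_norm, normSq_apply, sq, sq]

theorem inner_mul_mul_right (z w δ : ℂ) :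
    inner ℝ (z * δ) (w * δ) = inner ℝ z w * ‖δ‖ ^ 2 := by
  simp only [real_inner_eq_re_mul_re_add_im_mul_im, sq_norm_eq_sq_re_add_sq_im, mul_re, mul_im]
  ring

/-- The sector in which the cubic nonlinearity of the planar model acts, with `u` the squared
modulus of the equilibrium. -/
def InSector (u : ℝ) (σ : ℂ) : Prop :=
  σ.im ^ 2 ≤ 2 * u * σ.re ∧ u ≤ 4 * σ.re

/-- In a direction in which the cubic part of the planar field acts as multiplication by `σ`, the
gradient of the storage function is a positive multiple of multiplication by this number. -/
noncomputable def storageMultiplier (k σ : ℂ) : ℂ :=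
  ((‖k‖ ^ 2 : ℝ) : ℂ) + (k.re : ℂ) * σ

theorem storageMultiplier_re (k σ : ℂ) :
    (storageMultiplier k σ).re = ‖k‖ ^ 2 + k.re * σ.re := by
  rw [storageMultiplier, add_re, ofReal_re, re_ofReal_mul]

theorem storageMultiplier_im (k σ : ℂ) : (storageMultiplier k σ).im = k.re * σ.im := by
  rw [storageMultiplier, add_im, ofReal_im, im_ofReal_mul, zero_add]

namespace InSector

variable {u : ℝ} {k σ : ℂ}

theorem mul (hσ : InSector u σ) {a : ℝ} (ha : 0 ≤ a) : InSector (a * u) (a * σ) := by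
  obtain ⟨him, hre⟩ := hσ
  refine ⟨?_, ?_⟩
  · simp only [re_ofReal_mul, im_ofReal_mul]
    linarith [mul_le_mul_of_nonneg_left him (sq_nonneg a)]
  · rw [re_ofReal_mul]
    linarith [mul_le_mul_of_nonneg_left hre ha]

theorem re_nonneg (hσ : InSector u σ) (hu : 0 ≤ u) : 0 ≤ σ.re := by
  linarith [hσ.2]

theorem abs_mul_im_le (hσ : InSector u σ) (hu : 0 ≤ u) (b c : ℝ) :
    |b * c * σ.im| ≤ b ^ 2 * σ.re + c ^ 2 * u / 2 := by
  have hre := hσ.re_nonneg hu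
  refine abs_le_of_sq_le_sq ?_ (by positivity)
  calc (b * c * σ.im) ^ 2 = (b * c) ^ 2 * σ.im ^ 2 := mul_pow ..
    _ ≤ (b * c) ^ 2 * (2 * u * σ.re) := by gcongr; exact hσ.1
    _ ≤ (b ^ 2 * σ.re + c ^ 2 * u / 2) ^ 2 := by
      linarith [sq_nonneg (b ^ 2 * σ.re - c ^ 2 * u / 2)]

theorem re_mul_sq_norm_add_le (hσ : InSector u σ) (hu : 0 ≤ u) :
    k.re * ‖k + σ‖ ^ 2 ≤ inner ℝ (storageMultiplier k σ) (k + σ) + k.re ^ 2 * u / 2 := by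
  have hsplit : inner ℝ (storageMultiplier k σ) (k + σ) =
      k.re * ‖k + σ‖ ^ 2 + (k.im ^ 2 * σ.re - k.im * k.re * σ.im) := by
    simp only [sq_norm_eq_sq_re_add_sq_im, real_inner_eq_re_mul_re_add_im_mul_im,
      storageMultiplier_re, storageMultiplier_im, add_re, add_im]
    ring
  linarith [le_of_abs_le (hσ.abs_mul_im_le hu k.im k.re)]

theorem le_inner_storageMultiplier (hσ : InSector u σ) (hu : 0 ≤ u) (hk : 0 ≤ k.re) :
    3 / 4 * k.re * ‖k‖ ^ 2 ≤ inner ℝ (storageMultiplier k σ) (k + σ) := by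
  have hre := hσ.re_nonneg hu
  have hsplit : inner ℝ (storageMultiplier k σ) (k + σ) = 3 / 4 * k.re * ‖k‖ ^ 2 + k.re ^ 3 / 4
      + k.re * (σ.im + k.im / 2) ^ 2 + (‖k‖ ^ 2 + k.re ^ 2 + k.re * σ.re) * σ.re := by
    simp only [sq_norm_eq_sq_re_add_sq_im, real_inner_eq_re_mul_re_add_im_mul_im,
      storageMultiplier_re, storageMultiplier_im, add_re, add_im]
    ring
  have hrest : 0 ≤ k.re ^ 3 / 4 + k.re * (σ.im + k.im / 2) ^ 2
      + (‖k‖ ^ 2 + k.re ^ 2 + k.re * σ.re) * σ.re := by positivity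
  linarith

theorem re_mul_sq_norm_storageMultiplier_le (hσ : InSector u σ) (hu : 0 ≤ u) (hk : 0 < k.re) :
    k.re * ‖storageMultiplier k σ‖ ^ 2 ≤
      (‖k‖ ^ 2 + k.re * u) * inner ℝ (storageMultiplier k σ) (k + σ) := by
  set G := ‖storageMultiplier k σ‖ ^ 2
  set Y := inner ℝ (storageMultiplier k σ) (k + σ)
  have hk0 : 0 < ‖k‖ ^ 2 := pow_pos (hk.trans_le (re_le_norm k)) 2
  have hG : ‖k‖ ^ 2 * (‖k‖ ^ 2 + k.re * u) ≤ 2 * G := by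
    have hsplit : 2 * G = 2 * (‖k‖ ^ 2 + k.re * σ.re) ^ 2 + 2 * (k.re * σ.im) ^ 2 := by
      simp only [G, sq_norm_eq_sq_re_add_sq_im, storageMultiplier_re, storageMultiplier_im]
      ring
    have hgain : ‖k‖ ^ 2 * (k.re * (u - 4 * σ.re)) ≤ 0 :=
      mul_nonpos_of_nonneg_of_nonpos hk0.le
        (mul_nonpos_of_nonneg_of_nonpos hk.le (sub_nonpos.2 hσ.2))
    linarith [sq_nonneg (‖k‖ ^ 2), sq_nonneg (k.re * σ.re), sq_nonneg (k.re * σ.im)]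
  have hY : k.re * G - ‖k‖ ^ 2 * (k.re ^ 2 * u / 2) ≤ ‖k‖ ^ 2 * Y := by
    have hsplit : ‖k‖ ^ 2 * Y = k.re * G + k.re * k.im ^ 2 * ‖σ‖ ^ 2
        + ‖k‖ ^ 2 * (k.im ^ 2 * σ.re + k.im * k.re * σ.im) := by
      simp only [Y, G, sq_norm_eq_sq_re_add_sq_im, real_inner_eq_re_mul_re_add_im_mul_im,
        storageMultiplier_re, storageMultiplier_im, add_re, add_im]
      ring
    have hcross := mul_le_mul_of_nonneg_left
      (neg_le_of_abs_le (hσ.abs_mul_im_le hu k.im k.re)) hk0.le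
    have hrest : 0 ≤ k.re * k.im ^ 2 * ‖σ‖ ^ 2 := by positivity
    linarith
  refine le_of_mul_le_mul_left ?_ hk0
  calc ‖k‖ ^ 2 * (k.re * G)
      = (‖k‖ ^ 2 + k.re * u) * (k.re * G) - k.re ^ 2 * u / 2 * (2 * G) := by ring
    _ ≤ (‖k‖ ^ 2 + k.re * u) * (k.re * G)
          - k.re ^ 2 * u / 2 * (‖k‖ ^ 2 * (‖k‖ ^ 2 + k.re * u)) := by gcongr
    _ = (‖k‖ ^ 2 + k.re * u) * (k.re * G - ‖k‖ ^ 2 * (k.re ^ 2 * u / 2)) := by ring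
    _ ≤ (‖k‖ ^ 2 + k.re * u) * (‖k‖ ^ 2 * Y) := by gcongr
    _ = ‖k‖ ^ 2 * ((‖k‖ ^ 2 + k.re * u) * Y) := by ring

theorem sq_norm_add_le (hσ : InSector u σ) (hu : 0 ≤ u) (hk : 0 < k.re) :
    k.re * (‖k‖ ^ 2 + k.re * u) * ‖k + σ‖ ^ 2 ≤
      (‖k‖ + u) ^ 2 * inner ℝ (storageMultiplier k σ) (k + σ) := by
  set Y := inner ℝ (storageMultiplier k σ) (k + σ)
  have hkn : k.re ≤ ‖k‖ := re_le_norm k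
  have hY : 3 / 4 * k.re * ‖k‖ ^ 2 ≤ Y := hσ.le_inner_storageMultiplier hu hk.le
  have hY0 : 0 ≤ Y := le_trans (by positivity) hY
  have hsurplus : (‖k‖ ^ 2 + k.re * u) * (k.re ^ 2 / 2) ≤ (‖k‖ + u) * Y := by
    calc (‖k‖ ^ 2 + k.re * u) * (k.re ^ 2 / 2)
        ≤ (‖k‖ ^ 2 + ‖k‖ * u) * (k.re * ‖k‖ / 2) := by rw [sq k.re]; gcongr
      _ = (‖k‖ + u) * (1 / 2 * k.re * ‖k‖ ^ 2) := by ring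
      _ ≤ (‖k‖ + u) * (3 / 4 * k.re * ‖k‖ ^ 2) := by
        gcongr (‖k‖ + u) * (?_ * k.re * ‖k‖ ^ 2)
        norm_num
      _ ≤ (‖k‖ + u) * Y := by gcongr
  calc k.re * (‖k‖ ^ 2 + k.re * u) * ‖k + σ‖ ^ 2
      = (‖k‖ ^ 2 + k.re * u) * (k.re * ‖k + σ‖ ^ 2) := by ring
    _ ≤ (‖k‖ ^ 2 + k.re * u) * (Y + k.re ^ 2 * u / 2) := by
      gcongr
      exact hσ.re_mul_sq_norm_add_le hu
    _ = (‖k‖ ^ 2 + k.re * u) * Y + u * ((‖k‖ ^ 2 + k.re * u) * (k.re ^ 2 / 2)) := by ring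
    _ ≤ (‖k‖ ^ 2 + ‖k‖ * u) * Y + u * ((‖k‖ + u) * Y) := by gcongr
    _ = (‖k‖ + u) ^ 2 * Y := by ring

end InSector

/-- The cubic part `‖v + δ‖² (v + δ) - ‖v‖² v` of the amplitude regulation at `v`, less half of
its radial linearization `‖v‖² δ`: what remains maps every `δ` into a sector. -/
noncomputable def cubicSurplus (v δ : ℂ) : ℂ :=
  (‖v + δ‖ ^ 2 - ‖v‖ ^ 2) • (v + δ) + (‖v‖ ^ 2 / 2) • δ

theorem sq_norm_mul_sq_norm_le (v δ : ℂ) :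
    ‖v‖ ^ 2 * ‖δ‖ ^ 2 ≤ 2 * ‖v + δ‖ ^ 2 * ‖δ‖ ^ 2 + 2 * (‖v + δ‖ ^ 2 - ‖v‖ ^ 2) ^ 2 := by
  have hδ : ‖δ‖ ^ 2 ≤ (‖v + δ‖ + ‖v‖) ^ 2 := by
    gcongr
    simpa using norm_sub_le (v + δ) v
  rcases le_total (‖v‖ ^ 2) (2 * ‖v + δ‖ ^ 2) with h | h
  · linarith [mul_le_mul_of_nonneg_right h (sq_nonneg ‖δ‖), sq_nonneg (‖v + δ‖ ^ 2 - ‖v‖ ^ 2)]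
  · linarith [mul_le_mul_of_nonneg_left hδ (sub_nonneg.2 h),
      mul_nonneg (sq_nonneg (‖v‖ - 2 * ‖v + δ‖)) (sq_nonneg (‖v + δ‖ + ‖v‖))]

theorem cubicSurplus_eq_mul (v : ℂ) {δ : ℂ} (hδ : δ ≠ 0) :
    cubicSurplus v δ = ⟨‖v + δ‖ ^ 2 / 2 + (‖v + δ‖ ^ 2 - ‖v‖ ^ 2) ^ 2 / (2 * ‖δ‖ ^ 2),
      (‖v + δ‖ ^ 2 - ‖v‖ ^ 2) * (δ.re * v.im - δ.im * v.re) / ‖δ‖ ^ 2⟩ * δ := by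
  have hδ' : ‖δ‖ ^ 2 ≠ 0 := pow_ne_zero 2 (norm_ne_zero_iff.2 hδ)
  rw [sq_norm_eq_sq_re_add_sq_im] at hδ'
  apply Complex.ext
  · simp only [cubicSurplus, sq_norm_eq_sq_re_add_sq_im, add_re, add_im, smul_re,
      smul_eq_mul, mul_re]
    field_simp
    ring
  · simp only [cubicSurplus, sq_norm_eq_sq_re_add_sq_im, add_re, add_im, smul_im,
      smul_eq_mul, mul_im]
    field_simp
    ring

theorem exists_inSector_cubicSurplus_eq_mul (v δ : ℂ) :
    ∃ σ : ℂ, InSector (‖v‖ ^ 2) σ ∧ cubicSurplus v δ = σ * δ := by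
  rcases eq_or_ne δ 0 with rfl | hδ
  · refine ⟨(‖v‖ ^ 2 : ℝ), ⟨?_, ?_⟩, by simp [cubicSurplus]⟩
    · rw [ofReal_im, ofReal_re, mul_right_comm, zero_pow two_ne_zero]; positivity
    · rw [ofReal_re]; linarith [sq_nonneg ‖v‖]
  refine ⟨_, ⟨?_, ?_⟩, cubicSurplus_eq_mul v hδ⟩
  · have hcross : (δ.re * v.im - δ.im * v.re) ^ 2 ≤ ‖δ‖ ^ 2 * ‖v‖ ^ 2 := by
      simp only [sq_norm_eq_sq_re_add_sq_im]
      linarith [sq_nonneg (δ.re * v.re + δ.im * v.im)]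
    calc ((‖v + δ‖ ^ 2 - ‖v‖ ^ 2) * (δ.re * v.im - δ.im * v.re) / ‖δ‖ ^ 2) ^ 2
        = (‖v + δ‖ ^ 2 - ‖v‖ ^ 2) ^ 2 * (δ.re * v.im - δ.im * v.re) ^ 2 / (‖δ‖ ^ 2) ^ 2 := by
          rw [div_pow, mul_pow]
      _ ≤ (‖v + δ‖ ^ 2 - ‖v‖ ^ 2) ^ 2 * (‖δ‖ ^ 2 * ‖v‖ ^ 2) / (‖δ‖ ^ 2) ^ 2 := by gcongr
      _ = 2 * ‖v‖ ^ 2 * ((‖v + δ‖ ^ 2 - ‖v‖ ^ 2) ^ 2 / (2 * ‖δ‖ ^ 2)) := by field_simp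
      _ ≤ _ := by
        gcongr
        exact le_add_of_nonneg_left (by positivity)
  · have hsplit : 4 * (‖v + δ‖ ^ 2 / 2 + (‖v + δ‖ ^ 2 - ‖v‖ ^ 2) ^ 2 / (2 * ‖δ‖ ^ 2)) =
        (2 * ‖v + δ‖ ^ 2 * ‖δ‖ ^ 2 + 2 * (‖v + δ‖ ^ 2 - ‖v‖ ^ 2) ^ 2) / ‖δ‖ ^ 2 := by
      field_simp
      ring
    rw [hsplit, le_div_iff₀ (by positivity)]
    exact sq_norm_mul_sq_norm_le v δ

/-- The planar vector field `δ ↦ k δ + a N(δ)` with `N` the cubic surplus at the equilibrium `v`: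
the reference model with all other states at their quasi-steady values, in the deviation `δ` from
`v`, in reversed time and with the gain `η` divided out. -/
structure PlanarModel where
  k : ℂ
  a : ℝ
  v : ℂ

namespace PlanarModel

noncomputable section

variable (M : PlanarModel)

/-- Velocity of the planar model. -/
def field (δ : ℂ) : ℂ :=
  M.k * δ + M.a • cubicSurplus M.v δ

/-- Normalization of the storage function that makes the decay rate bound its gradient. -/
def gain : ℝ :=
  ‖M.k‖ ^ 2 + M.k.re * (M.a * ‖M.v‖ ^ 2)

/-- Storage function of the planar model. The quartic part is an antiderivative of the cubic
surplus. -/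
def storage (δ : ℂ) : ℝ :=
  M.gain⁻¹ * (‖M.k‖ ^ 2 * (‖δ‖ ^ 2 / 2) + M.k.re * M.a *
    ((‖M.v‖ ^ 2 * ‖δ‖ ^ 2 + (‖M.v + δ‖ ^ 2 - ‖M.v‖ ^ 2) ^ 2) / 4))

/-- Gradient of the storage function. -/
def grad (δ : ℂ) : ℂ :=
  M.gain⁻¹ • (‖M.k‖ ^ 2 • δ + (M.k.re * M.a) • cubicSurplus M.v δ)

/-- Square root of the decay rate of the storage function per unit of `k.re`. -/
def rate (δ : ℂ) : ℝ :=
  √(inner ℝ (M.grad δ) (M.field δ) / M.k.re)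

theorem hasFDerivAt_storage (δ : ℂ) :
    HasFDerivAt M.storage (innerSL ℝ (M.grad δ)) δ := by
  have hid : HasFDerivAt (fun δ : ℂ => δ) (ContinuousLinearMap.id ℝ ℂ) δ := hasFDerivAt_id δ
  have h := (((hid.norm_sq.mul_const 2⁻¹).const_mul (‖M.k‖ ^ 2)).add
    (((hid.norm_sq.const_mul (‖M.v‖ ^ 2)).add
      (((hid.const_add M.v).norm_sq.sub_const (‖M.v‖ ^ 2)).pow 2)).mul_const 4⁻¹
      |>.const_mul (M.k.re * M.a))).const_mul M.gain⁻¹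
  refine (HasFDerivAt.congr_fderiv h (ContinuousLinearMap.ext fun w => ?_)).congr_of_eventuallyEq
    (Eventually.of_forall fun x => ?_)
  · simp only [grad, cubicSurplus, add_apply, smul_apply, ContinuousLinearMap.comp_id,
      innerSL_apply_apply, inner_add_left, real_inner_smul_left, smul_eq_mul, nsmul_eq_mul]
    ring
  · simp only [storage, Pi.add_apply]
    ring

theorem contDiff_storage : ContDiff ℝ 1 M.storage := by
  have hnorm : ContDiff ℝ 1 fun δ : ℂ => ‖δ‖ ^ 2 := contDiff_norm_sq ℝ
  have hshift : ContDiff ℝ 1 fun δ : ℂ => ‖M.v + δ‖ ^ 2 :=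
    hnorm.comp (contDiff_const.add contDiff_id)
  unfold storage
  fun_prop

theorem storage_zero : M.storage 0 = 0 := by
  simp [storage]

variable {M}

theorem gain_pos (ha : 0 ≤ M.a) (hk : 0 < M.k.re) : 0 < M.gain := by
  have : 0 < ‖M.k‖ := hk.trans_le (re_le_norm M.k)
  unfold gain
  positivity

theorem hasQuadraticGrowth_storage (ha : 0 ≤ M.a) (hk : 0 < M.k.re) :
    HasQuadraticGrowth M.storage := by
  have hk' : 0 < ‖M.k‖ := hk.trans_le (re_le_norm M.k)
  have hgain := gain_pos ha hk
  refine ⟨M.gain⁻¹ * (‖M.k‖ ^ 2 / 2), by positivity, fun δ => ?_⟩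
  rw [mul_assoc]
  refine mul_le_mul_of_nonneg_left ?_ (by positivity)
  have hquartic : 0 ≤ M.k.re * M.a *
      ((‖M.v‖ ^ 2 * ‖δ‖ ^ 2 + (‖M.v + δ‖ ^ 2 - ‖M.v‖ ^ 2) ^ 2) / 4) := by positivity
  linarith

theorem exists_inSector_field_grad_eq_mul (ha : 0 ≤ M.a) (δ : ℂ) :
    ∃ σ : ℂ, InSector (M.a * ‖M.v‖ ^ 2) σ ∧ M.field δ = (M.k + σ) * δ ∧
      M.grad δ = M.gain⁻¹ • (storageMultiplier M.k σ * δ) := by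
  obtain ⟨σ, hσ, hN⟩ := exists_inSector_cubicSurplus_eq_mul M.v δ
  refine ⟨M.a * σ, hσ.mul ha, ?_, ?_⟩
  · rw [field, hN, real_smul]
    ring
  · simp only [grad, storageMultiplier, hN, real_smul]
    push_cast
    ring

theorem inner_grad_field_eq {σ δ : ℂ} (hfield : M.field δ = (M.k + σ) * δ)
    (hgrad : M.grad δ = M.gain⁻¹ • (storageMultiplier M.k σ * δ)) :
    inner ℝ (M.grad δ) (M.field δ) =
      M.gain⁻¹ * inner ℝ (storageMultiplier M.k σ) (M.k + σ) * ‖δ‖ ^ 2 := by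
  rw [hfield, hgrad, real_inner_smul_left, inner_mul_mul_right, mul_assoc]

section Rate

variable (ha : 0 ≤ M.a) (hk : 0 < M.k.re)
include ha hk

theorem inner_grad_field_pos {δ : ℂ} (hδ : δ ≠ 0) : 0 < inner ℝ (M.grad δ) (M.field δ) := by
  obtain ⟨σ, hσ, hfield, hgrad⟩ := exists_inSector_field_grad_eq_mul ha δ
  have hgain := gain_pos ha hk
  have hk' : 0 < ‖M.k‖ := hk.trans_le (re_le_norm M.k)
  have hinner : 0 < inner ℝ (storageMultiplier M.k σ) (M.k + σ) :=
    lt_of_lt_of_le (by positivity) (hσ.le_inner_storageMultiplier (by positivity) hk.le)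
  rw [inner_grad_field_eq hfield hgrad]
  positivity

theorem inner_grad_field_eq_mul_sq_rate (δ : ℂ) :
    inner ℝ (M.grad δ) (M.field δ) = M.k.re * M.rate δ ^ 2 := by
  have hinner : 0 ≤ inner ℝ (M.grad δ) (M.field δ) := by
    rcases eq_or_ne δ 0 with rfl | hδ
    · simp [field, cubicSurplus]
    · exact (inner_grad_field_pos ha hk hδ).le
  rw [rate, Real.sq_sqrt (by positivity), mul_div_cancel₀ _ hk.ne']

theorem rate_pos {δ : ℂ} (hδ : δ ≠ 0) : 0 < M.rate δ :=
  Real.sqrt_pos.2 (div_pos (inner_grad_field_pos ha hk hδ) hk)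

theorem norm_grad_le_rate (δ : ℂ) : ‖M.grad δ‖ ≤ M.rate δ := by
  obtain ⟨σ, hσ, hfield, hgrad⟩ := exists_inSector_field_grad_eq_mul ha δ
  have hgain := gain_pos ha hk
  refine Real.le_sqrt_of_sq_le ((le_div_iff₀' hk).2 ?_)
  rw [inner_grad_field_eq hfield hgrad, hgrad, norm_smul, norm_mul,
    Real.norm_of_nonneg (by positivity)]
  calc M.k.re * (M.gain⁻¹ * (‖storageMultiplier M.k σ‖ * ‖δ‖)) ^ 2
      = M.gain⁻¹ ^ 2 * (M.k.re * ‖storageMultiplier M.k σ‖ ^ 2) * ‖δ‖ ^ 2 := by ring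
    _ ≤ M.gain⁻¹ ^ 2 * (M.gain * inner ℝ (storageMultiplier M.k σ) (M.k + σ)) * ‖δ‖ ^ 2 := by
      gcongr M.gain⁻¹ ^ 2 * ?_ * ‖δ‖ ^ 2
      exact hσ.re_mul_sq_norm_storageMultiplier_le (by positivity) hk
    _ = M.gain⁻¹ * inner ℝ (storageMultiplier M.k σ) (M.k + σ) * ‖δ‖ ^ 2 := by
      field_simp

theorem norm_field_le_mul_rate (δ : ℂ) :
    ‖M.field δ‖ ≤ (‖M.k‖ + M.a * ‖M.v‖ ^ 2) * M.rate δ := by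
  obtain ⟨σ, hσ, hfield, hgrad⟩ := exists_inSector_field_grad_eq_mul ha δ
  have hgain := gain_pos ha hk
  have hrate : M.k.re * M.gain * M.rate δ ^ 2 =
      inner ℝ (storageMultiplier M.k σ) (M.k + σ) * ‖δ‖ ^ 2 := by
    rw [mul_right_comm, ← inner_grad_field_eq_mul_sq_rate ha hk, inner_grad_field_eq hfield hgrad]
    field_simp
  have hrate_nonneg : 0 ≤ M.rate δ := Real.sqrt_nonneg _
  refine le_of_abs_le (abs_le_of_sq_le_sq ?_ (by positivity))
  refine le_of_mul_le_mul_left ?_ (mul_pos hk hgain)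
  calc M.k.re * M.gain * ‖M.field δ‖ ^ 2
      = M.k.re * M.gain * ‖M.k + σ‖ ^ 2 * ‖δ‖ ^ 2 := by rw [hfield, norm_mul]; ring
    _ ≤ (‖M.k‖ + M.a * ‖M.v‖ ^ 2) ^ 2 * inner ℝ (storageMultiplier M.k σ) (M.k + σ) * ‖δ‖ ^ 2 := by
      gcongr ?_ * ‖δ‖ ^ 2
      exact hσ.sq_norm_add_le (by positivity) hk
    _ = M.k.re * M.gain * ((‖M.k‖ + M.a * ‖M.v‖ ^ 2) * M.rate δ) ^ 2 := by
      linear_combination -(‖M.k‖ + M.a * ‖M.v‖ ^ 2) ^ 2 * hrate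

end Rate

end

end PlanarModel

/-! ### Stability margins of the converter -/

namespace GridConverter

theorem Admissible.z_re_pos {P : GridConverter} (hP : P.Admissible) : 0 < P.z.re := by
  simpa [z] using hP.rg_pos

theorem Admissible.z_ne_zero {P : GridConverter} (hP : P.Admissible) : P.z ≠ 0 :=
  fun hz => hP.z_re_pos.ne' (by rw [hz, zero_re])

theorem Admissible.norm_y_pos {P : GridConverter} (hP : P.Admissible) : 0 < ‖P.y‖ := by
  simpa [y] using hP.z_ne_zero

theorem Admissible.β₂₃_pos {P : GridConverter} (hP : P.Admissible) : 0 < P.β₂₃ :=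
  one_div_pos.2 hP.rg_pos

theorem Admissible.cv_pos {P : GridConverter} (hP : P.Admissible) : 0 < P.cv :=
  add_pos (div_pos hP.cf_pos hP.kpv_pos) (div_pos hP.cf_pos hP.krv_pos)

theorem Admissible.β₃₂_pos {P : GridConverter} (hP : P.Admissible) : 0 < P.β₃₂ :=
  mul_pos hP.cv_pos hP.η_pos

theorem Admissible.β₃₄_pos {P : GridConverter} (hP : P.Admissible) : 0 < P.β₃₄ :=
  add_pos (one_div_pos.2 hP.kpv_pos) (one_div_pos.2 hP.krv_pos)

theorem Admissible.γ₂_pos {P : GridConverter} (hP : P.Admissible) : 0 < P.γ₂ :=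
  mul_pos (mul_pos hP.η_pos (div_pos hP.lg_pos hP.rg_pos)) hP.norm_y_pos

theorem Admissible.γ₄t_nonneg {P : GridConverter} (hP : P.Admissible) : 0 ≤ P.γ₄t :=
  div_nonneg (norm_nonneg _) hP.cf_pos.le

theorem β₂₁_eq (P : GridConverter) (vs : ℂ) (ε : ℝ) : P.β₂₁ vs ε = P.cε vs ε * P.γ₂ := by
  unfold β₂₁ γ₂
  ring

theorem β₄₃t_eq (P : GridConverter) :
    P.β₄₃t = 1 / P.lg + (P.γ₄t * (P.kpv + P.krv) + P.krv) := by
  unfold β₄₃t γ₄t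
  ring

theorem Admissible.β₄₃t_pos {P : GridConverter} (hP : P.Admissible) : 0 < P.β₄₃t := by
  have := hP.lg_pos
  have := hP.kpv_pos
  have := hP.krv_pos
  have := hP.γ₄t_nonneg
  rw [β₄₃t_eq]
  positivity

theorem c₂_eq_minEigenvalue (P : GridConverter) (vs : ℂ) (c₁ ε : ℝ) :
    P.c₂ vs c₁ ε = minEigenvalue (P.β₂₁ vs ε * c₁) (1 - P.γ₂) (P.β₂₁ vs ε ^ 2) := by
  simp only [c₂, D₂, minEigenvalue, α₂, β₁₂, div_one]
  ring_nf

theorem c₃_eq_minEigenvalue (P : GridConverter) (vs : ℂ) (c₁ ε : ℝ) :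
    P.c₃ vs c₁ ε = minEigenvalue (P.β₃₂ / P.β₂₃ * P.c₂ vs c₁ ε) P.α₃
      ((1 / 2 * P.β₃₁ vs ε) ^ 2 + P.β₃₂ ^ 2) := by
  simp only [c₃, D₃, minEigenvalue, γ₃, sub_zero]
  ring_nf

theorem Admissible.c₃_lt_one {P : GridConverter} (hP : P.Admissible) (vs : ℂ) (c₁ ε : ℝ) :
    P.c₃ vs c₁ ε < 1 := by
  rw [c₃_eq_minEigenvalue]
  exact (minEigenvalue_le_right (by positivity)).trans_lt
    (sub_lt_self 1 (div_pos hP.cf_pos hP.krv_pos))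

/-- The storage gain `l_f / k_p^c + l_f / k_r^c` of the current loop, the analogue of `cv`. -/
noncomputable def cc (P : GridConverter) : ℝ := P.lf / P.kpc + P.lf / P.krc

/-- The gain from the capacitor and voltage loop errors to the rate of the current reference. It
is `β₄₃t` with `k_p^v + k_r^v` sharpened to the Euclidean norm of the pair. -/
noncomputable def capGain (P : GridConverter) : ℝ :=
  1 / P.lg + (P.γ₄t * √(P.kpv ^ 2 + P.krv ^ 2) + P.krv)

/-- The stability margin of the whole cascade, continuing the sequence `c₁`, `c₂`, `c₃`. -/
noncomputable def c₄ (P : GridConverter) (vs : ℂ) (c₁ ε : ℝ) : ℝ :=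
  minEigenvalue (P.cc * P.β₄₃t / P.β₃₄ * P.c₃ vs c₁ ε) (1 - P.lf / P.krc - P.cc * P.γ₄t)
    (P.cc ^ 2 / 4 * (P.β₄₁t vs ε ^ 2 + P.β₄₂t ^ 2 + (P.β₄₃t + P.capGain) ^ 2))

theorem Admissible.cc_pos {P : GridConverter} (hP : P.Admissible) : 0 < P.cc :=
  add_pos (div_pos hP.lf_pos hP.kpc_pos) (div_pos hP.lf_pos hP.krc_pos)

theorem Admissible.capGain_pos {P : GridConverter} (hP : P.Admissible) : 0 < P.capGain := by
  have := hP.lg_pos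
  have := hP.krv_pos
  have := hP.γ₄t_nonneg
  unfold capGain
  positivity

theorem Admissible.capGain_add_le {P : GridConverter} (hP : P.Admissible) :
    P.capGain + P.γ₄t / P.β₃₄ ≤ P.β₄₃t := by
  have hp := hP.kpv_pos
  have hr := hP.krv_pos
  have hsqrt : √(P.kpv ^ 2 + P.krv ^ 2) + 1 / P.β₃₄ ≤ P.kpv + P.krv := by
    have hβ : P.kpv + P.krv - 1 / P.β₃₄ =
        (P.kpv ^ 2 + P.kpv * P.krv + P.krv ^ 2) / (P.kpv + P.krv) := by
      unfold β₃₄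
      field_simp
      ring
    rw [← le_sub_iff_add_le, hβ]
    refine Real.sqrt_le_iff.2 ⟨by positivity, ?_⟩
    rw [div_pow, le_div_iff₀ (by positivity)]
    linarith [sq_nonneg (P.kpv * P.krv)]
  rw [β₄₃t_eq, capGain, div_eq_mul_one_div P.γ₄t]
  linarith [mul_le_mul_of_nonneg_left hsqrt hP.γ₄t_nonneg]

/-- The planar model of the reference voltage around `vs` when the grid current is at its
quasi-steady value `Y (v̂ - vs)` relative to the equilibrium. -/
noncomputable def planar (P : GridConverter) (vs : ℂ) : PlanarModel where
  k := -(P.sStar - P.rot * P.y + (P.α : ℂ)) + ((P.α / P.vStar ^ 2 * ‖vs‖ ^ 2 / 2 : ℝ) : ℂ)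
  a := P.α / P.vStar ^ 2
  v := vs

/-- The stability conditions with `ε > 3` relaxed to `ε ≥ 3 / 2`, the range in which `c_ε` bounds
the planar model on the whole plane. -/
structure GlobalStabilityConditions (P : GridConverter) (vs : ℂ) (c₁ ε : ℝ) : Prop where
  c₁_pos : 0 < c₁
  three_halves_le_ε : 3 / 2 ≤ ε
  condA : (P.sStar).re + P.α + c₁
    < 1 / 2 * (P.α * ‖vs‖ ^ 2 / P.vStar ^ 2) + (P.rot * P.y).re
  condB : P.η < c₁ / (P.lg / P.rg * ‖P.y‖ * (c₁ + P.cε vs ε))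
  condC : 0 < (1 + P.krv / P.kpv) / (P.krv / P.cf - 1) ∧
    (1 + P.krv / P.kpv) / (P.krv / P.cf - 1)
      < 4 * P.c₂ vs c₁ ε / (1 / P.rg * P.η * (P.cε vs ε ^ 2 + 4))
  condD : 0 < (1 + P.krc / P.kpc) / (P.krc / P.lf - 1) ∧
    (1 + P.krc / P.kpc) / (P.krc / P.lf - 1)
      < 4 * P.c₃ vs c₁ ε / (P.β₃₄ / P.β₄₃t
          * (P.β₄₁t vs ε ^ 2 + P.β₄₂t ^ 2 + 4 * P.β₄₃t ^ 2)
        + P.c₃ vs c₁ ε * P.γ₄t)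

theorem StabilityConditions.globalStabilityConditions {P : GridConverter} {vs : ℂ} {c₁ ε : ℝ}
    (hc : P.StabilityConditions vs c₁ ε) : P.GlobalStabilityConditions vs c₁ ε where
  c₁_pos := hc.c₁_pos
  three_halves_le_ε := by linarith [hc.three_lt_ε]
  condA := hc.condA
  condB := hc.condB.2
  condC := hc.condC
  condD := hc.condD

theorem lt_of_div_sub_one_pos {c kp kr : ℝ} (hc : 0 < c) (hkp : 0 < kp) (hkr : 0 < kr)
    (h : 0 < (1 + kr / kp) / (kr / c - 1)) : c < kr := by
  have hsub := (div_pos_iff_of_pos_left (by positivity)).1 h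
  rwa [sub_pos, one_lt_div hc] at hsub

theorem div_sub_one_eq {c kp kr : ℝ} (hc : 0 < c) (hkp : 0 < kp) (hckr : c < kr) :
    (1 + kr / kp) / (kr / c - 1) = (c / kp + c / kr) / (1 - c / kr) := by
  have hkr := hc.trans hckr
  have hsub : kr - c ≠ 0 := (sub_pos.2 hckr).ne'
  rw [div_sub_one hc.ne', one_sub_div hkr.ne']
  field_simp
  ring

namespace GlobalStabilityConditions

variable {P : GridConverter} {vs : ℂ} {c₁ ε : ℝ} (hc : P.GlobalStabilityConditions vs c₁ ε)
include hc

theorem cf_lt_krv (hP : P.Admissible) : P.cf < P.krv :=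
  lt_of_div_sub_one_pos hP.cf_pos hP.kpv_pos hP.krv_pos hc.condC.1

theorem lf_lt_krc (hP : P.Admissible) : P.lf < P.krc :=
  lt_of_div_sub_one_pos hP.lf_pos hP.kpc_pos hP.krc_pos hc.condD.1

theorem c₁_lt_planar_k_re : c₁ < (P.planar vs).k.re := by
  have hcond := hc.condA
  simp only [planar, add_re, neg_re, sub_re, ofReal_re]
  linear_combination hcond

theorem norm_planar_k_add_le (hP : P.Admissible) :
    ‖(P.planar vs).k‖ + (P.planar vs).a * ‖(P.planar vs).v‖ ^ 2 ≤ P.cε vs ε := by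
  have hα := hP.α_nonneg
  calc ‖(P.planar vs).k‖ + P.α / P.vStar ^ 2 * ‖vs‖ ^ 2
      ≤ (‖P.sStar - P.rot * P.y + (P.α : ℂ)‖ + P.α / P.vStar ^ 2 * ‖vs‖ ^ 2 / 2)
        + P.α / P.vStar ^ 2 * ‖vs‖ ^ 2 := by
        gcongr
        refine (norm_add_le _ _).trans_eq ?_
        rw [norm_neg, Complex.norm_of_nonneg (by positivity)]
    _ = ‖P.sStar - P.rot * P.y + (P.α : ℂ)‖ + 3 / 2 * (P.α / P.vStar ^ 2 * ‖vs‖ ^ 2) := by ring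
    _ ≤ ‖P.sStar - P.rot * P.y + (P.α : ℂ)‖ + ε * (P.α / P.vStar ^ 2 * ‖vs‖ ^ 2) := by
        gcongr
        exact hc.three_halves_le_ε
    _ = P.cε vs ε := by
        unfold cε
        ring

theorem cε_pos (hP : P.Admissible) : 0 < P.cε vs ε := by
  have hα := hP.α_nonneg
  have hv : 0 ≤ (P.planar vs).a * ‖(P.planar vs).v‖ ^ 2 :=
    mul_nonneg (div_nonneg hα (by positivity)) (by positivity)
  linarith [hc.norm_planar_k_add_le hP, hc.c₁_lt_planar_k_re, hc.c₁_pos,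
    re_le_norm (P.planar vs).k]

theorem β₂₁_pos (hP : P.Admissible) : 0 < P.β₂₁ vs ε := by
  rw [β₂₁_eq]
  exact mul_pos (hc.cε_pos hP) hP.γ₂_pos

theorem γ₂_mul_lt (hP : P.Admissible) : P.γ₂ * (c₁ + P.cε vs ε) < c₁ := by
  have hden : 0 < P.lg / P.rg * ‖P.y‖ * (c₁ + P.cε vs ε) :=
    mul_pos (mul_pos (div_pos hP.lg_pos hP.rg_pos) hP.norm_y_pos)
      (add_pos hc.c₁_pos (hc.cε_pos hP))
  calc P.γ₂ * (c₁ + P.cε vs ε) = P.η * (P.lg / P.rg * ‖P.y‖ * (c₁ + P.cε vs ε)) := by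
        unfold γ₂
        ring
    _ < c₁ := (lt_div_iff₀ hden).1 hc.condB

theorem c₂_pos (hP : P.Admissible) : 0 < P.c₂ vs c₁ ε := by
  have hβ := hc.β₂₁_pos hP
  have hγ : P.γ₂ * c₁ + P.β₂₁ vs ε < c₁ := by
    rw [β₂₁_eq]
    linarith [hc.γ₂_mul_lt hP]
  have hγ_lt : P.γ₂ < 1 := lt_of_mul_lt_mul_right (by linarith) hc.c₁_pos.le
  rw [c₂_eq_minEigenvalue]
  refine minEigenvalue_pos (mul_pos hβ hc.c₁_pos) (sub_pos.2 hγ_lt) ?_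
  calc P.β₂₁ vs ε ^ 2 = P.β₂₁ vs ε * P.β₂₁ vs ε := sq _
    _ < P.β₂₁ vs ε * (c₁ * (1 - P.γ₂)) := mul_lt_mul_of_pos_left (by linarith) hβ
    _ = P.β₂₁ vs ε * c₁ * (1 - P.γ₂) := (mul_assoc _ _ _).symm

theorem α₃_pos (hP : P.Admissible) : 0 < P.α₃ :=
  sub_pos.2 ((div_lt_one hP.krv_pos).2 (hc.cf_lt_krv hP))

theorem c₃_pos (hP : P.Admissible) : 0 < P.c₃ vs c₁ ε := by
  have hrg := hP.rg_pos
  have hη := hP.η_pos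
  have hcv := hP.cv_pos
  have hα := hc.α₃_pos hP
  have hcond := hc.condC.2
  rw [div_sub_one_eq hP.cf_pos hP.kpv_pos (hc.cf_lt_krv hP), ← cv, ← α₃,
    div_lt_div_iff₀ hα (by positivity)] at hcond
  rw [c₃_eq_minEigenvalue]
  refine minEigenvalue_pos (mul_pos (div_pos hP.β₃₂_pos hP.β₂₃_pos) (hc.c₂_pos hP)) hα ?_
  calc (1 / 2 * P.β₃₁ vs ε) ^ 2 + P.β₃₂ ^ 2
      = P.cv * P.η * P.rg / 4 * (P.cv * (1 / P.rg * P.η * (P.cε vs ε ^ 2 + 4))) := by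
        unfold β₃₁ β₃₂
        field_simp
        ring
    _ < P.cv * P.η * P.rg / 4 * (4 * P.c₂ vs c₁ ε * P.α₃) := by gcongr
    _ = P.β₃₂ / P.β₂₃ * P.c₂ vs c₁ ε * P.α₃ := by
        unfold β₃₂ β₂₃
        field_simp

theorem current_loop_condition (hP : P.Admissible) :
    P.cc * (P.β₃₄ / P.β₄₃t * (P.β₄₁t vs ε ^ 2 + P.β₄₂t ^ 2 + 4 * P.β₄₃t ^ 2)
      + P.c₃ vs c₁ ε * P.γ₄t) < 4 * P.c₃ vs c₁ ε * (1 - P.lf / P.krc) := by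
  have hα : 0 < 1 - P.lf / P.krc := sub_pos.2 ((div_lt_one hP.krc_pos).2 (hc.lf_lt_krc hP))
  have hcond := hc.condD
  rw [div_sub_one_eq hP.lf_pos hP.kpc_pos (hc.lf_lt_krc hP), ← cc] at hcond
  have hden : 0 < P.β₃₄ / P.β₄₃t * (P.β₄₁t vs ε ^ 2 + P.β₄₂t ^ 2 + 4 * P.β₄₃t ^ 2)
      + P.c₃ vs c₁ ε * P.γ₄t :=
    (div_pos_iff_of_pos_left (by linarith [hc.c₃_pos hP])).1 (hcond.1.trans hcond.2)
  exact (div_lt_div_iff₀ hα hden).1 hcond.2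

/-- Condition (d) carries `c₃ γ̃₄` where the quadratic form needs `4 c₃ γ̃₄`; as `c₃ < 1`, the gap
between `capGain` and `β₄₃t` makes up for the difference. -/
theorem sq_β₄₃t_add_capGain_le (hP : P.Admissible) :
    (P.β₄₃t + P.capGain) ^ 2 ≤
      4 * P.β₄₃t ^ 2 - 3 * (P.β₄₃t * P.c₃ vs c₁ ε * P.γ₄t / P.β₃₄) := by
  have hβ := hP.β₃₄_pos
  have hγ := hP.γ₄t_nonneg
  have hcap := hP.capGain_pos
  have hgap : P.c₃ vs c₁ ε * P.γ₄t / P.β₃₄ ≤ P.β₄₃t - P.capGain := by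
    calc P.c₃ vs c₁ ε * P.γ₄t / P.β₃₄ ≤ 1 * P.γ₄t / P.β₃₄ := by
          gcongr
          exact (hP.c₃_lt_one vs c₁ ε).le
      _ ≤ P.β₄₃t - P.capGain := by
          rw [one_mul]
          linarith [hP.capGain_add_le]
  have hle : 0 ≤ P.β₄₃t - P.capGain :=
    le_trans (by have := hc.c₃_pos hP; positivity) hgap
  have hmul := mul_le_mul_of_nonneg_left hgap (by linarith : 0 ≤ P.β₄₃t)
  calc (P.β₄₃t + P.capGain) ^ 2
      ≤ 4 * P.β₄₃t ^ 2 - 3 * (P.β₄₃t * (P.β₄₃t - P.capGain)) := by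
        linarith [mul_nonneg hle hcap.le]
    _ ≤ 4 * P.β₄₃t ^ 2 - 3 * (P.β₄₃t * (P.c₃ vs c₁ ε * P.γ₄t / P.β₃₄)) := by gcongr
    _ = 4 * P.β₄₃t ^ 2 - 3 * (P.β₄₃t * P.c₃ vs c₁ ε * P.γ₄t / P.β₃₄) := by ring

theorem outer_coupling_lt (hP : P.Admissible) :
    P.cc ^ 2 / 4 * (P.β₄₁t vs ε ^ 2 + P.β₄₂t ^ 2 + (P.β₄₃t + P.capGain) ^ 2) <
      P.cc * P.β₄₃t / P.β₃₄ * P.c₃ vs c₁ ε * (1 - P.lf / P.krc - P.cc * P.γ₄t) := by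
  have hcc := hP.cc_pos
  have hβ₃₄ := hP.β₃₄_pos
  have hβ₄₃ := hP.β₄₃t_pos
  have hcond := mul_lt_mul_of_pos_left (hc.current_loop_condition hP)
    (by positivity : 0 < P.cc * P.β₄₃t / (4 * P.β₃₄))
  have hcap := mul_le_mul_of_nonneg_left (hc.sq_β₄₃t_add_capGain_le hP)
    (by positivity : 0 ≤ P.cc ^ 2 / 4)
  have hexpand : P.cc * P.β₄₃t / (4 * P.β₃₄) * (P.cc *
      (P.β₃₄ / P.β₄₃t * (P.β₄₁t vs ε ^ 2 + P.β₄₂t ^ 2 + 4 * P.β₄₃t ^ 2)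
        + P.c₃ vs c₁ ε * P.γ₄t)) =
      P.cc ^ 2 / 4 * (P.β₄₁t vs ε ^ 2 + P.β₄₂t ^ 2 + 4 * P.β₄₃t ^ 2)
        + P.cc ^ 2 / 4 * (P.β₄₃t * P.c₃ vs c₁ ε * P.γ₄t / P.β₃₄) := by
    field_simp
  linear_combination hcond + hcap - hexpand

theorem c₄_pos (hP : P.Admissible) : 0 < P.c₄ vs c₁ ε := by
  have hcoupling := hc.outer_coupling_lt hP
  have hp : 0 < P.cc * P.β₄₃t / P.β₃₄ * P.c₃ vs c₁ ε :=
    mul_pos (div_pos (mul_pos hP.cc_pos hP.β₄₃t_pos) hP.β₃₄_pos) (hc.c₃_pos hP)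
  exact minEigenvalue_pos hp (pos_of_mul_pos_right (lt_of_le_of_lt (by positivity) hcoupling) hp.le)
    hcoupling

end GlobalStabilityConditions

/-! ### Error coordinates -/

open ConverterState

/-- Passage from the deviation `w` from an equilibrium to the error coordinates, in which every
layer is measured from the quasi-steady state that the slower layers impose on it. -/
noncomputable def toError (P : GridConverter) : ConverterState →L[ℝ] ConverterState :=
  LinearMap.toContinuousLinearMap
    { toFun := fun w => (w.vHat, w.iOut - P.y * w.vHat, (w.vCap - w.vHat, w.ζv),
        (w.iInd - P.iRef w, w.ζc))
      map_add' := fun u w => by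
        simp only [iRef, vHat, iOut, vCap, ζv, iInd, ζc, Prod.fst_add, Prod.snd_add,
          Prod.mk_add_mk, Prod.mk.injEq, true_and, and_true]
        refine ⟨?_, ?_, ?_⟩ <;> ring
      map_smul' := fun r w => by
        simp only [iRef, vHat, iOut, vCap, ζv, iInd, ζc, Prod.smul_fst, Prod.smul_snd,
          Prod.smul_mk, Prod.mk.injEq, RingHom.id_apply, real_smul, true_and, and_true]
        refine ⟨?_, ?_, ?_⟩ <;> ring }

theorem toError_apply (P : GridConverter) (w : ConverterState) :
    P.toError w = (w.vHat, w.iOut - P.y * w.vHat, (w.vCap - w.vHat, w.ζv),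
      (w.iInd - P.iRef w, w.ζc)) :=
  rfl

theorem toError_injective (P : GridConverter) : Function.Injective P.toError := by
  refine (injective_iff_map_eq_zero P.toError).2 fun w hw => ?_
  simp only [toError_apply, Prod.mk_eq_zero] at hw
  obtain ⟨hvHat, hi, ⟨hv, hζv⟩, hif, hζc⟩ := hw
  rw [hvHat, mul_zero, sub_zero] at hi
  rw [hvHat, sub_zero] at hv
  simp only [iRef, hvHat, hi, hv, hζv, mul_zero, sub_zero, add_zero] at hif
  exact Prod.ext hvHat (Prod.ext hi (Prod.ext (Prod.ext hv hζv) (Prod.ext hif hζc)))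

/-- The velocity of the converter state as a function of the error `u`, relative to an equilibrium
with reference voltage `vs` in the frame rotating with the grid. -/
noncomputable def velocity (P : GridConverter) (vs : ℂ) (u : ConverterState) : ConverterState :=
  (-(P.η : ℂ) * ((P.planar vs).field u.vHat + P.rot * u.iOut),
    (P.lg : ℂ)⁻¹ * (u.vCap - P.z * u.iOut),
    ((P.cf : ℂ)⁻¹ * (-(P.kpv : ℂ) * u.vCap - (P.krv : ℂ) * u.ζv + u.iInd), u.vCap),
    ((P.lf : ℂ)⁻¹ * (-(P.kpc : ℂ) * u.iInd - (P.krc : ℂ) * u.ζc), u.iInd))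

/-- The converter dynamics in error coordinates. -/
noncomputable def errorField (P : GridConverter) (vs : ℂ) (u : ConverterState) : ConverterState :=
  P.toError (P.velocity vs u)

section Equilibrium

variable {P : GridConverter} {xs : ConverterState} (hxs : P.field xs = 0)
include hxs

theorem f₂_eq_velocity (hP : P.Admissible) (x : ConverterState) :
    P.f₂ x = (P.velocity xs.vHat (P.toError (x - xs))).2.1 := by
  have hequil : P.f₂ xs = 0 := congrArg (·.2.1) hxs
  have hzy : P.z * P.y = 1 := mul_inv_cancel₀ hP.z_ne_zero
  simp only [f₂] at hequil
  simp only [f₂, velocity, toError_apply, vHat, iOut, vCap, Prod.fst_sub, Prod.snd_sub]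
  linear_combination hequil - (P.lg : ℂ)⁻¹ * (x.vHat - xs.vHat) * hzy

variable (hω : P.ωΔ = 0)
include hω

theorem f₁_eq_velocity (hP : P.Admissible) (x : ConverterState) :
    P.f₁ x = (P.velocity xs.vHat (P.toError (x - xs))).1 := by
  have hv := hP.vStar_pos.ne'
  have hequil : P.f₁ xs = 0 := congrArg Prod.fst hxs
  have hamp (w : ℂ) : P.ampReg w = 1 - ‖w‖ ^ 2 / P.vStar ^ 2 := by
    rw [ampReg, sub_div, div_self (pow_ne_zero 2 hv)]
  simp only [f₁, hω, hamp] at hequil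
  simp only [f₁, hω, hamp, velocity, toError_apply, PlanarModel.field, planar, cubicSurplus,
    vHat, iOut, Prod.fst_sub, Prod.snd_sub, add_sub_cancel, real_smul]
  push_cast at hequil ⊢
  linear_combination hequil

theorem f₃_eq_velocity (x : ConverterState) :
    P.f₃ x = (P.velocity xs.vHat (P.toError (x - xs))).2.2.1 := by
  have hequil : P.f₃ xs = 0 := congrArg (·.2.2.1) hxs
  simp only [f₃, hω, ofReal_zero, mul_zero, zero_mul, zero_add, Prod.mk_eq_zero] at hequil
  simp only [f₃, hω, ofReal_zero, mul_zero, zero_mul, zero_add, velocity, toError_apply, iRef,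
    vHat, iOut, vCap, ζv, iInd, ζc, Prod.fst_sub, Prod.snd_sub, Prod.mk.injEq]
  constructor
  · linear_combination hequil.1
  · linear_combination hequil.2

theorem f₄_eq_velocity (x : ConverterState) :
    P.f₄ x = (P.velocity xs.vHat (P.toError (x - xs))).2.2.2 := by
  have hequil : P.f₄ xs = 0 := congrArg (·.2.2.2) hxs
  simp only [f₄, hω, ofReal_zero, mul_zero, zero_mul, zero_add, Prod.mk_eq_zero] at hequil
  simp only [iRef] at hequil
  simp only [f₄, hω, ofReal_zero, mul_zero, zero_mul, zero_add, velocity, toError_apply, iRef,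
    vHat, iOut, vCap, ζv, iInd, ζc, Prod.fst_sub, Prod.snd_sub, Prod.mk.injEq]
  constructor
  · linear_combination hequil.1
  · linear_combination hequil.2

theorem toError_field_eq (hP : P.Admissible) (x : ConverterState) :
    P.toError (P.field x) = P.errorField xs.vHat (P.toError (x - xs)) :=
  congrArg P.toError (Prod.ext (f₁_eq_velocity hxs hω hP x) (Prod.ext (f₂_eq_velocity hxs hP x)
    (Prod.ext (f₃_eq_velocity hxs hω x) (f₄_eq_velocity hxs hω x))))

end Equilibrium

/-! ### The nested Lyapunov function -/

section Layers

variable {P : GridConverter} {vs : ℂ} {c₁ ε : ℝ}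

theorem norm_rot (P : GridConverter) : ‖P.rot‖ = 1 := by
  rw [rot, mul_comm, norm_exp_ofReal_mul_I]

theorem planar_a_nonneg (hP : P.Admissible) : 0 ≤ (P.planar vs).a :=
  div_nonneg hP.α_nonneg (by positivity)

theorem velocity_iOut (u : ConverterState) :
    (P.velocity vs u).iOut = P.lg⁻¹ • (u.vCap - P.z * u.iOut) := by
  rw [real_smul, ofReal_inv]
  rfl

theorem errorField_voltageLoop (u : ConverterState) :
    (P.errorField vs u).2.2.1 = loopField P.cf P.kpv P.krv
      (P.cf⁻¹ • u.iInd - (P.velocity vs u).vHat) u.2.2.1 := by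
  simp only [errorField, toError_apply, velocity, loopField, real_smul, ofReal_inv, Prod.mk.injEq,
    and_true]
  ring

theorem errorField_currentLoop (u : ConverterState) :
    (P.errorField vs u).2.2.2 = loopField P.lf P.kpc P.krc (-P.iRef (P.velocity vs u)) u.2.2.2 := by
  simp only [errorField, toError_apply, velocity, loopField, real_smul, ofReal_inv, Prod.mk.injEq,
    and_true]
  ring

theorem inner_grad_errorField_le (hP : P.Admissible) (hc : P.GlobalStabilityConditions vs c₁ ε)
    (u : ConverterState) :
    inner ℝ ((P.planar vs).grad u.vHat) (P.errorField vs u).vHat / P.η ≤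
      -c₁ * (P.planar vs).rate u.vHat ^ 2 + (P.planar vs).rate u.vHat * ‖u.iOut‖ := by
  have ha := planar_a_nonneg (vs := vs) hP
  have hη := hP.η_pos
  have hk := hc.c₁_lt_planar_k_re
  have hvel : (P.errorField vs u).vHat =
      P.η • -((P.planar vs).field u.vHat + P.rot * u.iOut) := by
    rw [real_smul, mul_neg, ← neg_mul]
    rfl
  have hcouple : -inner ℝ ((P.planar vs).grad u.vHat) (P.rot * u.iOut) ≤
      (P.planar vs).rate u.vHat * ‖u.iOut‖ := by
    refine (neg_le_abs _).trans ((abs_real_inner_le_norm _ _).trans ?_)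
    rw [norm_mul, norm_rot, one_mul]
    gcongr
    exact PlanarModel.norm_grad_le_rate ha (hc.c₁_pos.trans hk) _
  rw [hvel, real_inner_smul_right, mul_div_cancel_left₀ _ hη.ne', inner_neg_right, inner_add_right,
    PlanarModel.inner_grad_field_eq_mul_sq_rate ha (hc.c₁_pos.trans hk)]
  linarith [mul_le_mul_of_nonneg_right hk.le (sq_nonneg ((P.planar vs).rate u.vHat))]

theorem norm_velocity_vHat_le (hP : P.Admissible) (hc : P.GlobalStabilityConditions vs c₁ ε)
    (u : ConverterState) : ‖(P.velocity vs u).vHat‖ ≤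
      P.η * (P.cε vs ε * (P.planar vs).rate u.vHat + ‖u.iOut‖) := by
  have hη := hP.η_pos
  have hrate : 0 ≤ (P.planar vs).rate u.vHat := Real.sqrt_nonneg _
  calc ‖(P.velocity vs u).vHat‖
      = P.η * ‖(P.planar vs).field u.vHat + P.rot * u.iOut‖ := by
        simp only [velocity, vHat, norm_mul, norm_neg, Complex.norm_of_nonneg hη.le]
    _ ≤ P.η * (‖(P.planar vs).field u.vHat‖ + ‖u.iOut‖) := by
        gcongr
        refine (norm_add_le _ _).trans_eq ?_
        rw [norm_mul, norm_rot, one_mul]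
    _ ≤ P.η * (P.cε vs ε * (P.planar vs).rate u.vHat + ‖u.iOut‖) := by
        gcongr
        refine (PlanarModel.norm_field_le_mul_rate (planar_a_nonneg hP)
          (hc.c₁_pos.trans hc.c₁_lt_planar_k_re) _).trans ?_
        gcongr
        exact hc.norm_planar_k_add_le hP

theorem inner_iOut_errorField_le (hP : P.Admissible) (hc : P.GlobalStabilityConditions vs c₁ ε)
    (u : ConverterState) :
    P.lg / P.rg * inner ℝ u.iOut (P.errorField vs u).iOut ≤
      -(1 - P.γ₂) * ‖u.iOut‖ ^ 2
        + P.β₂₁ vs ε * (P.planar vs).rate u.vHat * ‖u.iOut‖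
        + P.β₂₃ * ‖u.iOut‖ * ‖WithLp.toLp 2 u.2.2.1‖ := by
  have hrg := hP.rg_pos
  have hlg := hP.lg_pos
  have hvel : (P.errorField vs u).iOut =
      P.lg⁻¹ • (u.vCap - P.z * u.iOut) - P.y * (P.velocity vs u).vHat := by
    rw [← velocity_iOut]
    rfl
  have hz : inner ℝ u.iOut (P.z * u.iOut) = P.rg * ‖u.iOut‖ ^ 2 := by
    rw [← one_mul u.iOut, ← mul_assoc, mul_one, inner_mul_mul_right, one_mul]
    simp [z]
  have hv : inner ℝ u.iOut u.vCap ≤ ‖u.iOut‖ * ‖WithLp.toLp 2 u.2.2.1‖ := by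
    grw [real_inner_le_norm]
    gcongr
    exact WithLp.norm_fst_le ℂ (WithLp.toLp 2 u.2.2.1)
  have hy : -inner ℝ u.iOut (P.y * (P.velocity vs u).vHat) ≤
      ‖u.iOut‖ * (‖P.y‖ * (P.η * (P.cε vs ε * (P.planar vs).rate u.vHat + ‖u.iOut‖))) := by
    refine (neg_le_abs _).trans ((abs_real_inner_le_norm _ _).trans ?_)
    rw [norm_mul]
    gcongr
    exact norm_velocity_vHat_le hP hc u
  calc P.lg / P.rg * inner ℝ u.iOut (P.errorField vs u).iOut
      = -‖u.iOut‖ ^ 2 + 1 / P.rg * inner ℝ u.iOut u.vCap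
        + P.lg / P.rg * -inner ℝ u.iOut (P.y * (P.velocity vs u).vHat) := by
        rw [hvel, inner_sub_right, real_inner_smul_right, inner_sub_right, hz]
        field_simp
        ring
    _ ≤ -‖u.iOut‖ ^ 2 + 1 / P.rg * (‖u.iOut‖ * ‖WithLp.toLp 2 u.2.2.1‖)
        + P.lg / P.rg * (‖u.iOut‖ *
          (‖P.y‖ * (P.η * (P.cε vs ε * (P.planar vs).rate u.vHat + ‖u.iOut‖)))) := by gcongr
    _ = _ := by
        unfold γ₂ β₂₁ β₂₃
        ring

theorem fderiv_voltageLoop_errorField_le (hP : P.Admissible)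
    (hc : P.GlobalStabilityConditions vs c₁ ε) (u : ConverterState) :
    fderiv ℝ (loopStorage P.cf P.kpv P.krv) u.2.2.1 (P.errorField vs u).2.2.1 ≤
      -P.α₃ * ‖WithLp.toLp 2 u.2.2.1‖ ^ 2
        + (P.β₃₁ vs ε * (P.planar vs).rate u.vHat + P.β₃₂ * ‖u.iOut‖) * ‖WithLp.toLp 2 u.2.2.1‖
        + P.β₃₄ * ‖WithLp.toLp 2 u.2.2.1‖ * ‖WithLp.toLp 2 u.2.2.2‖ := by
  have hcf := hP.cf_pos
  have hcv := hP.cv_pos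
  have hdist : ‖P.cf⁻¹ • u.iInd - (P.velocity vs u).vHat‖ ≤ P.cf⁻¹ * ‖WithLp.toLp 2 u.2.2.2‖ +
      P.η * (P.cε vs ε * (P.planar vs).rate u.vHat + ‖u.iOut‖) := by
    refine (norm_sub_le _ _).trans (add_le_add ?_ (norm_velocity_vHat_le hP hc u))
    rw [norm_smul, Real.norm_of_nonneg (by positivity)]
    gcongr
    exact WithLp.norm_fst_le ℂ (WithLp.toLp 2 u.2.2.2)
  rw [errorField_voltageLoop]
  refine (fderiv_loopStorage_loopField_le hcf hP.kpv_pos hP.krv_pos _ _).trans ?_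
  rw [← α₃, ← cv]
  calc -P.α₃ * ‖WithLp.toLp 2 u.2.2.1‖ ^ 2
        + P.cv * ‖P.cf⁻¹ • u.iInd - (P.velocity vs u).vHat‖ * ‖WithLp.toLp 2 u.2.2.1‖
      ≤ -P.α₃ * ‖WithLp.toLp 2 u.2.2.1‖ ^ 2 + P.cv * (P.cf⁻¹ * ‖WithLp.toLp 2 u.2.2.2‖ +
        P.η * (P.cε vs ε * (P.planar vs).rate u.vHat + ‖u.iOut‖)) * ‖WithLp.toLp 2 u.2.2.1‖ := by
        gcongr
    _ = _ := by
        unfold β₃₁ β₃₂ β₃₄ cv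
        field_simp
        ring

theorem norm_iRef_velocity_le (hP : P.Admissible) (u : ConverterState) :
    ‖P.iRef (P.velocity vs u)‖ ≤ P.kpv * ‖(P.velocity vs u).vHat‖ + ‖P.z‖ / P.lg * ‖u.iOut‖
      + P.capGain * ‖WithLp.toLp 2 u.2.2.1‖ + P.γ₄t * ‖WithLp.toLp 2 u.2.2.2‖ := by
  have hkp := hP.kpv_pos
  have hkr := hP.krv_pos
  have hcf := hP.cf_pos
  have hlg := hP.lg_pos
  have hvCap : ‖u.vCap‖ ≤ ‖WithLp.toLp 2 u.2.2.1‖ := WithLp.norm_fst_le ℂ (WithLp.toLp 2 u.2.2.1)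
  have hiInd : ‖u.iInd‖ ≤ ‖WithLp.toLp 2 u.2.2.2‖ := WithLp.norm_fst_le ℂ (WithLp.toLp 2 u.2.2.2)
  have hsplit : P.iRef (P.velocity vs u) =
      P.kpv • (P.velocity vs u).vHat + P.lg⁻¹ • (u.vCap - P.z * u.iOut)
        + (P.yf - P.kpv) * (P.cf⁻¹ • (((-P.kpv) • u.vCap + (-P.krv) • u.ζv) + u.iInd))
        - P.krv • u.vCap := by
    simp only [iRef, velocity, real_smul, ofReal_inv, ofReal_neg]
    ring
  have hnetwork : ‖P.lg⁻¹ • (u.vCap - P.z * u.iOut)‖ ≤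
      P.lg⁻¹ * (‖WithLp.toLp 2 u.2.2.1‖ + ‖P.z‖ * ‖u.iOut‖) := by
    rw [norm_smul, Real.norm_of_nonneg (by positivity), ← norm_mul]
    gcongr
    exact (norm_sub_le _ _).trans (by gcongr)
  have hfilter : ‖(P.yf - P.kpv) * (P.cf⁻¹ • (((-P.kpv) • u.vCap + (-P.krv) • u.ζv) + u.iInd))‖ ≤
      P.γ₄t * (√(P.kpv ^ 2 + P.krv ^ 2) * ‖WithLp.toLp 2 u.2.2.1‖ + ‖WithLp.toLp 2 u.2.2.2‖) := by
    rw [norm_mul, norm_smul, Real.norm_of_nonneg (by positivity), γ₄t, div_eq_mul_inv, mul_assoc]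
    gcongr
    refine (norm_add_le _ _).trans (add_le_add ?_ hiInd)
    simpa only [neg_sq] using norm_smul_add_smul_le_sqrt_mul (-P.kpv) (-P.krv) u.2.2.1
  calc ‖P.iRef (P.velocity vs u)‖
      ≤ P.kpv * ‖(P.velocity vs u).vHat‖
        + P.lg⁻¹ * (‖WithLp.toLp 2 u.2.2.1‖ + ‖P.z‖ * ‖u.iOut‖)
        + P.γ₄t * (√(P.kpv ^ 2 + P.krv ^ 2) * ‖WithLp.toLp 2 u.2.2.1‖ + ‖WithLp.toLp 2 u.2.2.2‖)
        + P.krv * ‖WithLp.toLp 2 u.2.2.1‖ := by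
        rw [hsplit]
        refine norm_sub_le_of_le (norm_add_le_of_le (norm_add_le_of_le ?_ hnetwork) hfilter) ?_
        · rw [norm_smul, Real.norm_of_nonneg hkp.le]
        · rw [norm_smul, Real.norm_of_nonneg hkr.le]
          gcongr
    _ = _ := by
        unfold capGain
        ring

theorem fderiv_currentLoop_errorField_le (hP : P.Admissible)
    (hc : P.GlobalStabilityConditions vs c₁ ε) (u : ConverterState) :
    fderiv ℝ (loopStorage P.lf P.kpc P.krc) u.2.2.2 (P.errorField vs u).2.2.2 ≤
      -(1 - P.lf / P.krc - P.cc * P.γ₄t) * ‖WithLp.toLp 2 u.2.2.2‖ ^ 2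
        + P.cc * (P.β₄₁t vs ε * (P.planar vs).rate u.vHat + P.β₄₂t * ‖u.iOut‖
          + P.capGain * ‖WithLp.toLp 2 u.2.2.1‖) * ‖WithLp.toLp 2 u.2.2.2‖ := by
  have hkp := hP.kpv_pos
  have hcc := hP.cc_pos
  have hdist : ‖P.iRef (P.velocity vs u)‖ ≤ P.β₄₁t vs ε * (P.planar vs).rate u.vHat
      + P.β₄₂t * ‖u.iOut‖ + P.capGain * ‖WithLp.toLp 2 u.2.2.1‖
      + P.γ₄t * ‖WithLp.toLp 2 u.2.2.2‖ := by
    refine (norm_iRef_velocity_le hP u).trans ?_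
    unfold β₄₁t β₄₂t
    linarith [mul_le_mul_of_nonneg_left (norm_velocity_vHat_le hP hc u) hkp.le]
  rw [errorField_currentLoop]
  refine (fderiv_loopStorage_loopField_le hP.lf_pos hP.kpc_pos hP.krc_pos _ _).trans ?_
  rw [norm_neg, ← cc]
  linarith [mul_le_mul_of_nonneg_right (mul_le_mul_of_nonneg_left hdist hcc.le)
    (norm_nonneg (WithLp.toLp 2 u.2.2.2))]

/-- Storage function of the network and the reference voltage on which it acts. -/
noncomputable def networkStorage (P : GridConverter) (vs : ℂ) (ε : ℝ) (u : ConverterState) : ℝ :=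
  P.β₂₁ vs ε * ((P.planar vs).storage u.vHat / P.η) + P.lg / P.rg * (‖u.iOut‖ ^ 2 / 2)

/-- Storage function of the voltage loop and the layers on which it acts. -/
noncomputable def voltageStorage (P : GridConverter) (vs : ℂ) (ε : ℝ) (u : ConverterState) : ℝ :=
  P.β₃₂ / P.β₂₃ * P.networkStorage vs ε u + loopStorage P.cf P.kpv P.krv u.2.2.1

/-- The Lyapunov function of the converter in error coordinates: the storage function of the
current loop and the layers on which it acts. -/
noncomputable def lyapunov (P : GridConverter) (vs : ℂ) (ε : ℝ) (u : ConverterState) : ℝ :=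
  P.cc * P.β₄₃t / P.β₃₄ * P.voltageStorage vs ε u + loopStorage P.lf P.kpc P.krc u.2.2.2

theorem contDiff_networkStorage (P : GridConverter) (vs : ℂ) (ε : ℝ) :
    ContDiff ℝ 1 (P.networkStorage vs ε) :=
  (contDiff_const.mul (((P.planar vs).contDiff_storage.comp contDiff_fst).div_const P.η)).add
    (contDiff_const.mul ((contDiff_snd.fst.norm_sq ℝ).div_const 2))

theorem contDiff_voltageStorage (P : GridConverter) (vs : ℂ) (ε : ℝ) :
    ContDiff ℝ 1 (P.voltageStorage vs ε) :=
  (contDiff_const.mul (P.contDiff_networkStorage vs ε)).add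
    ((contDiff_loopStorage P.cf P.kpv P.krv).comp contDiff_snd.snd.fst)

theorem contDiff_lyapunov (P : GridConverter) (vs : ℂ) (ε : ℝ) :
    ContDiff ℝ 1 (P.lyapunov vs ε) :=
  (contDiff_const.mul (P.contDiff_voltageStorage vs ε)).add
    ((contDiff_loopStorage P.lf P.kpc P.krc).comp contDiff_snd.snd.snd)

theorem lyapunov_zero (P : GridConverter) (vs : ℂ) (ε : ℝ) : P.lyapunov vs ε 0 = 0 := by
  simp [lyapunov, voltageStorage, networkStorage, iOut, PlanarModel.storage_zero, loopStorage_zero]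

theorem hasQuadraticGrowth_lyapunov (hP : P.Admissible)
    (hc : P.GlobalStabilityConditions vs c₁ ε) : HasQuadraticGrowth (P.lyapunov vs ε) := by
  have hη := hP.η_pos
  have hlg := hP.lg_pos
  have hrg := hP.rg_pos
  have hw₂ := hc.β₂₁_pos hP
  have hw₃ : 0 < P.β₃₂ / P.β₂₃ := div_pos hP.β₃₂_pos hP.β₂₃_pos
  have hw₄ : 0 < P.cc * P.β₄₃t / P.β₃₄ := div_pos (mul_pos hP.cc_pos hP.β₄₃t_pos) hP.β₃₄_pos
  have hnorm : HasQuadraticGrowth fun i : ℂ => ‖i‖ ^ 2 :=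
    ⟨1, one_pos, fun i => (one_mul _).le⟩
  have hvHat := (P.planar vs).hasQuadraticGrowth_storage (planar_a_nonneg hP)
    (hc.c₁_pos.trans hc.c₁_lt_planar_k_re)
  have hvCap := hasQuadraticGrowth_loopStorage (E := ℂ) hP.cf_pos hP.kpv_pos (hc.cf_lt_krv hP)
  have hiInd := hasQuadraticGrowth_loopStorage (E := ℂ) hP.lf_pos hP.kpc_pos (hc.lf_lt_krc hP)
  convert (hvHat.const_mul (c := P.cc * P.β₄₃t / P.β₃₄ * (P.β₃₂ / P.β₂₃ * (P.β₂₁ vs ε / P.η)))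
    (by positivity)).prod <| (hnorm.const_mul
      (c := P.cc * P.β₄₃t / P.β₃₄ * (P.β₃₂ / P.β₂₃ * (P.lg / P.rg / 2))) (by positivity)).prod <|
    (hvCap.const_mul hw₄).prod hiInd using 2
  simp only [lyapunov, voltageStorage, networkStorage]
  ring

theorem fderiv_networkStorage_apply (u q : ConverterState) :
    fderiv ℝ (P.networkStorage vs ε) u q =
      P.β₂₁ vs ε * (inner ℝ ((P.planar vs).grad u.vHat) q.vHat / P.η)
        + P.lg / P.rg * inner ℝ u.iOut q.iOut := by
  have hvHat : HasFDerivAt (fun u : ConverterState => (P.planar vs).storage u.vHat)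
      ((innerSL ℝ ((P.planar vs).grad u.vHat)).comp (.fst ℝ ℂ _)) u :=
    ((P.planar vs).hasFDerivAt_storage u.vHat).comp u hasFDerivAt_fst
  have hiOut := (hasFDerivAt_fst.comp u (hasFDerivAt_snd (𝕜 := ℝ) (p := u))).norm_sq
  have h := ((hvHat.mul_const P.η⁻¹).const_mul (P.β₂₁ vs ε)).add
    ((hiOut.mul_const 2⁻¹).const_mul (P.lg / P.rg))
  rw [HasFDerivAt.fderiv (f := P.networkStorage vs ε) h]
  simp [vHat, iOut]
  ring

theorem fderiv_voltageStorage_apply (u q : ConverterState) :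
    fderiv ℝ (P.voltageStorage vs ε) u q =
      P.β₃₂ / P.β₂₃ * fderiv ℝ (P.networkStorage vs ε) u q
        + fderiv ℝ (loopStorage P.cf P.kpv P.krv) u.2.2.1 q.2.2.1 := by
  have hnetwork := ((P.contDiff_networkStorage vs ε).differentiable one_ne_zero u).hasFDerivAt
  have hloop := ((contDiff_loopStorage P.cf P.kpv P.krv).differentiable one_ne_zero
    u.2.2.1).hasFDerivAt.comp u
      (hasFDerivAt_fst.comp u (hasFDerivAt_snd.comp u (hasFDerivAt_snd (𝕜 := ℝ) (p := u))))
  rw [HasFDerivAt.fderiv (f := P.voltageStorage vs ε) ((hnetwork.const_mul _).add hloop)]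
  rfl

theorem fderiv_lyapunov_apply (u q : ConverterState) :
    fderiv ℝ (P.lyapunov vs ε) u q =
      P.cc * P.β₄₃t / P.β₃₄ * fderiv ℝ (P.voltageStorage vs ε) u q
        + fderiv ℝ (loopStorage P.lf P.kpc P.krc) u.2.2.2 q.2.2.2 := by
  have hvoltage := ((P.contDiff_voltageStorage vs ε).differentiable one_ne_zero u).hasFDerivAt
  have hloop := ((contDiff_loopStorage P.lf P.kpc P.krc).differentiable one_ne_zero
    u.2.2.2).hasFDerivAt.comp u
      (hasFDerivAt_snd.comp u (hasFDerivAt_snd.comp u (hasFDerivAt_snd (𝕜 := ℝ) (p := u))))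
  rw [HasFDerivAt.fderiv (f := P.lyapunov vs ε) ((hvoltage.const_mul _).add hloop)]
  rfl

theorem fderiv_networkStorage_errorField_le (hP : P.Admissible)
    (hc : P.GlobalStabilityConditions vs c₁ ε) (u : ConverterState) :
    fderiv ℝ (P.networkStorage vs ε) u (P.errorField vs u) ≤
      -P.c₂ vs c₁ ε * ((P.planar vs).rate u.vHat ^ 2 + ‖u.iOut‖ ^ 2)
        + P.β₂₃ * ‖u.iOut‖ * ‖WithLp.toLp 2 u.2.2.1‖ := by
  rw [fderiv_networkStorage_apply, c₂_eq_minEigenvalue]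
  refine mul_add_le_neg_minEigenvalue (hc.β₂₁_pos hP).le (sq_nonneg _) (sq_nonneg _)
    (inner_grad_errorField_le hP hc u) (inner_iOut_errorField_le hP hc u) (le_of_eq ?_)
  ring

theorem fderiv_voltageStorage_errorField_le (hP : P.Admissible)
    (hc : P.GlobalStabilityConditions vs c₁ ε) (u : ConverterState) :
    fderiv ℝ (P.voltageStorage vs ε) u (P.errorField vs u) ≤
      -P.c₃ vs c₁ ε * ((P.planar vs).rate u.vHat ^ 2 + ‖u.iOut‖ ^ 2
        + ‖WithLp.toLp 2 u.2.2.1‖ ^ 2)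
        + P.β₃₄ * ‖WithLp.toLp 2 u.2.2.1‖ * ‖WithLp.toLp 2 u.2.2.2‖ := by
  have hβ₂₃ := hP.β₂₃_pos.ne'
  rw [fderiv_voltageStorage_apply, c₃_eq_minEigenvalue]
  refine mul_add_le_neg_minEigenvalue (div_pos hP.β₃₂_pos hP.β₂₃_pos).le (by positivity)
    (by positivity) (fderiv_networkStorage_errorField_le hP hc u)
    (fderiv_voltageLoop_errorField_le hP hc u) ?_
  calc ((P.β₃₂ / P.β₂₃ * (P.β₂₃ * ‖u.iOut‖)
        + (P.β₃₁ vs ε * (P.planar vs).rate u.vHat + P.β₃₂ * ‖u.iOut‖)) / 2) ^ 2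
      = (1 / 2 * P.β₃₁ vs ε * (P.planar vs).rate u.vHat + P.β₃₂ * ‖u.iOut‖) ^ 2 := by
        field_simp
        ring
    _ ≤ ((1 / 2 * P.β₃₁ vs ε) ^ 2 + P.β₃₂ ^ 2)
        * ((P.planar vs).rate u.vHat ^ 2 + ‖u.iOut‖ ^ 2) := by
        linarith [sq_nonneg (1 / 2 * P.β₃₁ vs ε * ‖u.iOut‖ - P.β₃₂ * (P.planar vs).rate u.vHat)]

theorem fderiv_lyapunov_errorField_le (hP : P.Admissible)
    (hc : P.GlobalStabilityConditions vs c₁ ε) (u : ConverterState) :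
    fderiv ℝ (P.lyapunov vs ε) u (P.errorField vs u) ≤
      -P.c₄ vs c₁ ε * ((P.planar vs).rate u.vHat ^ 2 + ‖u.iOut‖ ^ 2
        + ‖WithLp.toLp 2 u.2.2.1‖ ^ 2 + ‖WithLp.toLp 2 u.2.2.2‖ ^ 2) := by
  have hβ₃₄ := hP.β₃₄_pos.ne'
  have hcurrent := fderiv_currentLoop_errorField_le hP hc u
  rw [← add_zero (_ + _ * ‖WithLp.toLp 2 u.2.2.2‖)] at hcurrent
  rw [fderiv_lyapunov_apply, ← add_zero (-P.c₄ vs c₁ ε * _)]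
  refine mul_add_le_neg_minEigenvalue (div_pos (mul_pos hP.cc_pos hP.β₄₃t_pos) hP.β₃₄_pos).le
    (by positivity) (by positivity) (fderiv_voltageStorage_errorField_le hP hc u) hcurrent ?_
  set ρ := (P.planar vs).rate u.vHat
  set a := ‖u.iOut‖
  set ψ := ‖WithLp.toLp 2 u.2.2.1‖
  set b := P.β₄₃t + P.capGain
  calc ((P.cc * P.β₄₃t / P.β₃₄ * (P.β₃₄ * ψ)
        + P.cc * (P.β₄₁t vs ε * ρ + P.β₄₂t * a + P.capGain * ψ)) / 2) ^ 2
      = P.cc ^ 2 / 4 * (P.β₄₁t vs ε * ρ + P.β₄₂t * a + b * ψ) ^ 2 := by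
        simp only [b]
        field_simp
        ring
    _ ≤ P.cc ^ 2 / 4 * ((P.β₄₁t vs ε ^ 2 + P.β₄₂t ^ 2 + b ^ 2) * (ρ ^ 2 + a ^ 2 + ψ ^ 2)) := by
        gcongr
        linarith [sq_nonneg (P.β₄₁t vs ε * a - P.β₄₂t * ρ), sq_nonneg (P.β₄₁t vs ε * ψ - b * ρ),
          sq_nonneg (P.β₄₂t * ψ - b * a)]
    _ = _ := (mul_assoc ..).symm

theorem fderiv_lyapunov_errorField_neg (hP : P.Admissible)
    (hc : P.GlobalStabilityConditions vs c₁ ε) {u : ConverterState} (hu : u ≠ 0) :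
    fderiv ℝ (P.lyapunov vs ε) u (P.errorField vs u) < 0 := by
  refine (fderiv_lyapunov_errorField_le hP hc u).trans_lt
    (mul_neg_of_neg_of_pos (neg_neg_of_pos (hc.c₄_pos hP)) ?_)
  by_cases hvHat : u.vHat = 0
  · have hrest : u.iOut ≠ 0 ∨ WithLp.toLp 2 u.2.2.1 ≠ 0 ∨ WithLp.toLp 2 u.2.2.2 ≠ 0 := by
      contrapose! hu
      simp only [WithLp.toLp_eq_zero] at hu
      exact Prod.ext hvHat (Prod.ext hu.1 (Prod.ext hu.2.1 hu.2.2))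
    rcases hrest with h | h | h <;> positivity
  · have hrate := PlanarModel.rate_pos (planar_a_nonneg hP)
      (hc.c₁_pos.trans hc.c₁_lt_planar_k_re) hvHat
    positivity

theorem isStrictLyapunov_lyapunov (hP : P.Admissible)
    (hc : P.GlobalStabilityConditions vs c₁ ε) :
    IsStrictLyapunov (P.errorField vs) 0 (P.lyapunov vs ε) where
  contDiff := P.contDiff_lyapunov vs ε
  apply_self := P.lyapunov_zero vs ε
  pos _ hu := (hasQuadraticGrowth_lyapunov hP hc).pos hu
  coercive := (hasQuadraticGrowth_lyapunov hP hc).tendsto_cocompact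
  decrease _ hu := fderiv_lyapunov_errorField_neg hP hc hu

theorem contDiff_field (P : GridConverter) : ContDiff ℝ 1 P.field := by
  have hsq : ContDiff ℝ 1 fun x : ConverterState => ((‖x.vHat‖ ^ 2 : ℝ) : ℂ) :=
    ofRealCLM.contDiff.comp ((contDiff_norm_sq ℝ).comp contDiff_fst)
  have hf₁ : ContDiff ℝ 1 P.f₁ := by
    unfold f₁ ampReg
    push_cast at hsq ⊢
    fun_prop
  have hf₂ : ContDiff ℝ 1 P.f₂ := by
    unfold f₂
    fun_prop
  have hf₃ : ContDiff ℝ 1 P.f₃ := by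
    unfold f₃
    fun_prop
  have hf₄ : ContDiff ℝ 1 P.f₄ := by
    unfold f₄ iRef
    fun_prop
  exact hf₁.prodMk (hf₂.prodMk (hf₃.prodMk hf₄))

theorem isStrictLyapunov_field (hP : P.Admissible) (hω : P.ωΔ = 0) {xs : ConverterState}
    (hxs : P.field xs = 0) (hc : P.GlobalStabilityConditions xs.vHat c₁ ε) :
    IsStrictLyapunov P.field xs fun x => P.lyapunov xs.vHat ε (P.toError (x - xs)) :=
  (isStrictLyapunov_lyapunov hP hc).comp_clm_sub P.toError P.toError_injective
    (toError_field_eq hxs hω hP)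

end Layers

end GridConverter

theorem exists_pos_cube_quotient_eq {n ε : ℝ} (hn : 0 < n) (hε : 3 < ε) :
    ∃ r : ℝ, 0 < r ∧ ((1 + r / n) ^ 3 - 1) / (r / n) = ε := by
  have hs : √(4 * ε - 3) ^ 2 = 4 * ε - 3 := Real.sq_sqrt (by linarith)
  have hpos : 0 < (√(4 * ε - 3) - 3) / 2 :=
    half_pos (sub_pos.2 ((Real.lt_sqrt (by norm_num)).2 (by linarith)))
  refine ⟨(√(4 * ε - 3) - 3) / 2 * n, mul_pos hpos hn, ?_⟩
  rw [mul_div_cancel_right₀ _ hn.ne', div_eq_iff hpos.ne']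
  linear_combination (√(4 * ε - 3) - 3) / 8 * hs

theorem mainTheorem3_general (P : GridConverter) (hP : P.Admissible) (hω : P.ωΔ = 0)
    (xs : ConverterState) (hxs : P.field xs = 0)
    (c₁ ε : ℝ) (hc : P.GlobalStabilityConditions xs.vHat c₁ ε) :
    AsymptoticallyStable P.field xs ∧ regionOfAttraction P.field xs = univ :=
  have hV := GridConverter.isStrictLyapunov_field hP hω hxs hc
  ⟨hV.asymptoticallyStable P.contDiff_field hxs,
    hV.regionOfAttraction_eq_univ P.contDiff_field hxs⟩

theorem mainTheorem3 (P : GridConverter) (hP : P.Admissible) (hω : P.ωΔ = 0)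
    (xs : ConverterState) (hxs : P.field xs = 0)
    (c₁ ε : ℝ) (hc : P.StabilityConditions xs.vHat c₁ ε) :
    AsymptoticallyStable P.field xs ∧
    (xs.vHat ≠ 0 → ∃ r : ℝ, 0 < r ∧
      ((1 + r / ‖xs.vHat‖) ^ 3 - 1) / (r / ‖xs.vHat‖) = ε ∧
      {x : ConverterState | ‖x.vHat - xs.vHat‖ < r} ⊆ regionOfAttraction P.field xs) := by
  obtain ⟨hstable, huniv⟩ :=
    mainTheorem3_general P hP hω xs hxs c₁ ε hc.globalStabilityConditions
  refine ⟨hstable, fun hv => ?_⟩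
  obtain ⟨r, hr, hrε⟩ := exists_pos_cube_quotient_eq (norm_pos_iff.2 hv) hc.three_lt_ε
  exact ⟨r, hr, hrε, huniv ▸ subset_univ _⟩
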